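/- Let $\mathbb{T}=\{z\in\mathbb{C}:|z|=1\}$, let $N\ge 2$ be an integer and $r(z)=z^N$ on $\mathbb{T}$. For $W\colon\mathbb{T}\to[0,\infty)$ put $R_Wf(x)=\sum_{y\in\mathbb{T},\,y^N=x}W(y)f(y)$. An invariant measure of $W$ is a Borel probability measure $\nu$ on $\mathbb{T}$ with $\int R_Wf\,d\nu=\int f\,d\nu$ for all $f\in C(\mathbb{T})$. A $W$-cycle is a periodic orbit $\{x,r(x),\dots,r^{n-1}(x)\}$, $r^n(x)=x$, $n\ge1$, with $W=1$ at each of its points. Call $W$ admissible if it is non-negative and Lipschitz, $R_W1=1$, there are no $W$-cycles, and $W$ has only finitely many zeros. Then: 1. Every admissible $W$ has exactly one invariant measure $\nu_W$. 2. If $W\neq W'$ are admissible, then $\nu_W$ and $\nu_{W'}$ are mutually singular. 3. In particular, if $W$ is admissible and is not the constant function $\frac1N$, then $\nu_W$ is singular with respect to Haar measure on $\mathbb{T}$. 4. For example, let $N=3$ and $W(z)=\frac13\left|\frac{1+z^2}{\sqrt2}\right|^2$, i.e. $W(e^{it})=\frac23\cos^2t$. The Riesz product $d\nu(t)=\frac1{2\pi}\prod_{k=0}^\infty\bigl(1+\cos(2\cdot3^kt)\bigr)\,dt$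 (the weak limit, as $n\to\infty$, of the measures $\frac1{2\pi}\prod_{k=0}^{n-1}(1+\cos(2\cdot3^kt))\,dt$) exists, is a probability measure invariant for $W$, and is singular with respect to Haar measure. -/

import Mathlib

open MeasureTheory Filter Topology

noncomputable section

/-- The Borel σ-algebra of the unit circle. -/
instance instMeasurableSpaceUnitCircle : MeasurableSpace Circle := borel Circle

instance instBorelSpaceUnitCircle : BorelSpace Circle := ⟨rfl⟩

/-- The Ruelle (transfer) operator of the endomorphism `z ↦ z ^ N` of the unit circle with weight
`W`: `(R_W f)(x) = ∑_{y ^ N = x} W(y) f(y)`. For `N ≥ 1` the sum is over a finite set. -/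
def ruelle (N : ℕ) (W f : Circle → ℝ) (x : Circle) : ℝ :=
  ∑ᶠ (y : Circle) (_ : y ^ N = x), W y * f y

/-- `x` lies on a `W`-cycle of `r(z) = z ^ N`: it is a periodic point of `r`, and `W = 1` at every
point of its orbit `{x, r(x), r²(x), …}`. -/
def OnWCycle (N : ℕ) (W : Circle → ℝ) (x : Circle) : Prop :=
  (∃ n : ℕ, 0 < n ∧ (fun z : Circle => z ^ N)^[n] x = x) ∧
    ∀ k : ℕ, W ((fun z : Circle => z ^ N)^[k] x) = 1

/-- The weights under consideration: non-negative Lipschitz functions `W` on the circle with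
`R_W 1 = 1`, without `W`-cycles and with only finitely many zeros. -/
structure IsAdmissibleWeight (N : ℕ) (W : Circle → ℝ) : Prop where
  nonneg : ∀ z, 0 ≤ W z
  lipschitz : ∃ K, LipschitzWith K W
  ruelle_one : ∀ x, ruelle N W (fun _ => 1) x = 1
  no_cycle : ∀ x, ¬ OnWCycle N W x
  finite_zeros : {z : Circle | W z = 0}.Finite

/-- `ν` is an invariant measure of `W`: a Borel probability measure on the circle with
`ν(R_W f) = ν(f)` for all continuous `f`. -/
def IsInvariantMeasure (N : ℕ) (W : Circle → ℝ) (ν : Measure Circle) : Prop :=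
  IsProbabilityMeasure ν ∧ ∀ f : C(Circle, ℝ), ∫ x, ruelle N W f x ∂ν = ∫ x, f x ∂ν

/-- The normalized Haar measure of the unit circle. -/
def circleHaar : Measure Circle := Measure.haarMeasure ⊤

/-- The weight `W(z) = (1/3) |(1 + z²) / √2|²`, i.e. `W(e^{it}) = (2/3) cos² t`. -/
def rieszWeight (z : Circle) : ℝ :=
  (1 / 3) * ‖(1 + (z : ℂ) ^ 2) / (Real.sqrt 2 : ℂ)‖ ^ 2

/-- The partial Riesz product `∏_{k < n} (1 + cos(2 · 3^k t))` at `z = e^{it}`; here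
`cos(2 · 3^k t) = Re z^{2 · 3^k}`. -/
def rieszPartial (n : ℕ) (z : Circle) : ℝ :=
  ∏ k ∈ Finset.range n, (1 + ((z : ℂ) ^ (2 * 3 ^ k)).re)

/-- `ν` is the Riesz product `∏_{k ≥ 0} (1 + cos(2 · 3^k t)) dt / 2π`: the probability measure that
is the weak limit of the measures whose densities with respect to the normalized Haar measure are
the partial products. -/
def IsRieszProduct (ν : Measure Circle) : Prop :=
  IsProbabilityMeasure ν ∧ ∀ f : C(Circle, ℝ),
    Tendsto (fun n => ∫ z, f z * rieszPartial n z ∂circleHaar) atTop (𝓝 (∫ z, f z ∂ν))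

end

/-! Write `r(z) = z ^ N`. The engine is a rigidity statement: under the hypotheses on `W`, a
nonempty closed set containing every preimage of its points at which `W ≠ 0` is the whole circle
(`backwardInvariant_eq_univ`). It is applied twice. For the set where an `R_W`-fixed continuous
function attains its maximum, it shows that such functions are constant. For the support of an
invariant measure, it shows that the support is full.

Uniqueness: `R_W` contracts angular Lipschitz constants by `1/N` up to a term `K‖f‖`, so the Cesàro
averages of `R_W^k f` are equi-Lipschitz. By Arzelà–Ascoli a subsequence converges to an `R_W`-fixed
function, which is a constant, and `∫ f` must equal it. Existence: an ultrafilter limit of Cesàro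
averages at one point.

Singularity: conditioning `ν_W` on an `r`-invariant set gives another invariant measure of `W`, so
uniqueness implies ergodicity, and distinct ergodic measures are mutually singular. If `W` and `W'`
share `ν`, testing both on `D = W - W'` gives `∫ ∑_{y ^ N = x} D(y)² dν = 0`, and full support
forces `D = 0`. Haar measure belongs to `W = 1/N`.

The Riesz product exists because its Fourier coefficients stabilise; it is invariant because its
density is formally `∏ (3W) ∘ r^k`. -/

noncomputable section

/-! ### Roots on the circle and the Ruelle operator -/

/-- The `k`-th branch of the `N`-th root of `exp t`. -/
def rootBranch (N : ℕ) (t : ℝ) (k : ℕ) : Circle := Circle.exp ((t + 2 * Real.pi * k) / N)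

theorem pow_eq_exp_iff {N : ℕ} (hN : N ≠ 0) (t : ℝ) (y : Circle) :
    y ^ N = Circle.exp t ↔ ∃ k ∈ Finset.range N, rootBranch N t k = y := by
  have hN' : (N : ℝ) ≠ 0 := Nat.cast_ne_zero.2 hN
  constructor
  · intro h
    obtain ⟨s, rfl⟩ := Circle.exp_surjective y
    rw [← Circle.exp_natCast_mul, Circle.exp_eq_exp] at h
    obtain ⟨m, hm⟩ := h
    have hNz : (0 : ℤ) < N := by exact_mod_cast Nat.pos_of_ne_zero hN
    refine ⟨(m % N).toNat, ?_, ?_⟩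
    · have h1 := Int.emod_lt_of_pos m hNz
      have h2 := Int.emod_nonneg m hNz.ne'
      rw [Finset.mem_range]
      omega
    · rw [rootBranch, Circle.exp_eq_exp]
      refine ⟨-(m / N), ?_⟩
      have h2 := Int.emod_nonneg m hNz.ne'
      have h3 : ((m % N).toNat : ℝ) = m - N * ((m / N : ℤ) : ℝ) := by
        have h4 : (((m % N).toNat : ℤ)) = m - N * (m / N) := by
          rw [Int.toNat_of_nonneg h2]
          have := Int.emod_add_mul_ediv m N
          omega
        exact_mod_cast h4
      rw [h3]
      push_cast
      field_simp
      linarith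
  · rintro ⟨k, -, rfl⟩
    rw [rootBranch, ← Circle.exp_natCast_mul, Circle.exp_eq_exp]
    refine ⟨k, ?_⟩
    push_cast
    field_simp

theorem rootBranch_injOn {N : ℕ} (hN : N ≠ 0) (t : ℝ) :
    Set.InjOn (rootBranch N t) (Finset.range N : Set ℕ) := by
  have hN' : (N : ℝ) ≠ 0 := Nat.cast_ne_zero.2 hN
  intro k hk j hj h
  simp only [Finset.coe_range, Set.mem_Iio] at hk hj
  simp only [rootBranch] at h
  rw [Circle.exp_eq_exp] at h
  obtain ⟨m, hm⟩ := h
  field_simp at hm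
  have h2 : (k : ℝ) = j + N * m := by
    have : 2 * Real.pi * ((k : ℝ) - (j + N * m)) = 0 := by linarith
    rcases mul_eq_zero.1 this with h | h
    · exact absurd h Real.two_pi_pos.ne'
    · linarith
  have h3 : (k : ℤ) = j + N * m := by exact_mod_cast h2
  have h4 : m = 0 := by
    rcases lt_trichotomy m 0 with h | h | h
    · nlinarith
    · exact h
    · nlinarith
  subst h4
  omega

theorem ruelle_exp {N : ℕ} (hN : N ≠ 0) (W f : Circle → ℝ) (t : ℝ) :
    ruelle N W f (Circle.exp t) =
      ∑ k ∈ Finset.range N, W (rootBranch N t k) * f (rootBranch N t k) := by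
  have hset : {y : Circle | y ^ N = Circle.exp t} =
      rootBranch N t '' (Finset.range N : Set ℕ) := by
    ext y
    simpa using pow_eq_exp_iff hN t y
  have h1 : ruelle N W f (Circle.exp t) =
      ∑ᶠ y ∈ {y : Circle | y ^ N = Circle.exp t}, W y * f y := rfl
  rw [h1, hset, finsum_mem_image (rootBranch_injOn hN t), finsum_mem_coe_finset]

theorem finite_roots {N : ℕ} (hN : N ≠ 0) (x : Circle) : {y : Circle | y ^ N = x}.Finite := by
  obtain ⟨t, rfl⟩ := Circle.exp_surjective x
  refine ((Finset.range N).finite_toSet.image (rootBranch N t)).subset fun y hy => ?_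
  simpa using (pow_eq_exp_iff hN t y).1 hy

/-- The finite set of `N`-th roots of a point of the circle. -/
def rootSet {N : ℕ} (hN : N ≠ 0) (x : Circle) : Finset Circle := (finite_roots hN x).toFinset

@[simp]
theorem mem_rootSet {N : ℕ} (hN : N ≠ 0) (x y : Circle) : y ∈ rootSet hN x ↔ y ^ N = x := by
  simp [rootSet]

theorem ruelle_eq_sum {N : ℕ} (hN : N ≠ 0) (W f : Circle → ℝ) (x : Circle) :
    ruelle N W f x = ∑ y ∈ rootSet hN x, W y * f y := by
  have h1 : ruelle N W f x = ∑ᶠ y ∈ {y : Circle | y ^ N = x}, W y * f y := rfl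
  rw [h1, finsum_mem_eq_finite_toFinset_sum _ (finite_roots hN x)]
  rfl

theorem continuous_of_continuous_comp_exp {f : Circle → ℝ}
    (h : Continuous fun t => f (Circle.exp t)) : Continuous f :=
  (Circle.isCoveringMap_exp.isQuotientMap Circle.exp_surjective).continuous_iff.2 h

/-- No branch of the root is continuous on the circle when `N ≥ 2`, but each is continuous in the
angle, and `Circle.exp` is a quotient map. -/
theorem continuous_ruelle {N : ℕ} (hN : N ≠ 0) {W f : Circle → ℝ} (hW : Continuous W)
    (hf : Continuous f) : Continuous (ruelle N W f) := by
  refine continuous_of_continuous_comp_exp ?_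
  simp only [ruelle_exp hN]
  unfold rootBranch
  fun_prop

/-- The Ruelle operator as a linear operator on the continuous functions on the circle. -/
def ruelleLin {N : ℕ} (hN : N ≠ 0) (W : C(Circle, ℝ)) : C(Circle, ℝ) →ₗ[ℝ] C(Circle, ℝ) where
  toFun f := ⟨ruelle N W f, continuous_ruelle hN W.continuous f.continuous⟩
  map_add' f g := by
    ext x
    simp [ruelle_eq_sum hN, mul_add, Finset.sum_add_distrib]
  map_smul' c f := by
    ext x
    simp only [ruelle_eq_sum hN, ContinuousMap.coe_mk, ContinuousMap.coe_smul, Pi.smul_apply,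
      smul_eq_mul, RingHom.id_apply, Finset.mul_sum]
    exact Finset.sum_congr rfl fun y _ => by ring

theorem ruelleLin_apply {N : ℕ} (hN : N ≠ 0) (W f : C(Circle, ℝ)) (x : Circle) :
    ruelleLin hN W f x = ruelle N W f x := rfl

theorem ruelle_mono {N : ℕ} (hN : N ≠ 0) {W f g : Circle → ℝ} (hW : ∀ z, 0 ≤ W z)
    (h : ∀ z, f z ≤ g z) (x : Circle) : ruelle N W f x ≤ ruelle N W g x := by
  rw [ruelle_eq_sum hN, ruelle_eq_sum hN]
  exact Finset.sum_le_sum fun y _ => mul_le_mul_of_nonneg_left (h y) (hW y)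

theorem ruelle_const {N : ℕ} (hN : N ≠ 0) {W : Circle → ℝ}
    (h1 : ∀ x, ruelle N W (fun _ => 1) x = 1) (c : ℝ) (x : Circle) :
    ruelle N W (fun _ => c) x = c := by
  have := h1 x
  rw [ruelle_eq_sum hN] at this ⊢
  simp only [mul_one] at this
  rw [← Finset.sum_mul, this, one_mul]

theorem norm_ruelleLin_le {N : ℕ} (hN : N ≠ 0) {W : C(Circle, ℝ)} (hW : ∀ z, 0 ≤ W z)
    (h1 : ∀ x, ruelle N W (fun _ => 1) x = 1) (f : C(Circle, ℝ)) :
    ‖ruelleLin hN W f‖ ≤ ‖f‖ := by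
  rw [ContinuousMap.norm_le _ (norm_nonneg _)]
  intro x
  rw [ruelleLin_apply, Real.norm_eq_abs, abs_le]
  constructor
  · rw [← ruelle_const hN h1 (-‖f‖) x]
    exact ruelle_mono hN hW (fun z => (abs_le.1 (f.norm_coe_le_norm z)).1) x
  · conv_rhs => rw [← ruelle_const hN h1 ‖f‖ x]
    exact ruelle_mono hN hW (fun z => (abs_le.1 (f.norm_coe_le_norm z)).2) x

theorem norm_ruelleLin_pow_le {N : ℕ} (hN : N ≠ 0) {W : C(Circle, ℝ)} (hW : ∀ z, 0 ≤ W z)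
    (h1 : ∀ x, ruelle N W (fun _ => 1) x = 1) (f : C(Circle, ℝ)) (k : ℕ) :
    ‖(ruelleLin hN W ^ k) f‖ ≤ ‖f‖ := by
  induction k with
  | zero => simp
  | succ k ih =>
    rw [pow_succ', Module.End.mul_apply]
    exact (norm_ruelleLin_le hN hW h1 _).trans ih

/-! ### Lipschitz estimates in the angle -/

/-- `f` is `L`-Lipschitz as a function of the angle. -/
def AngleLipschitz (L : ℝ) (f : Circle → ℝ) : Prop :=
  ∀ s t : ℝ, |f (Circle.exp s) - f (Circle.exp t)| ≤ L * |s - t|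

theorem dist_exp_le (s t : ℝ) : dist (Circle.exp s) (Circle.exp t) ≤ |s - t| := by
  have h : Circle.exp s = Circle.exp t * Circle.exp (s - t) := by
    rw [← Circle.exp_add]; congr 1; ring
  have h2 : dist (Circle.exp s) (Circle.exp t) =
      ‖(Circle.exp s : ℂ) - (Circle.exp t : ℂ)‖ := by
    rw [← Complex.dist_eq]; rfl
  rw [h2, h]
  have h3 : ((Circle.exp t * Circle.exp (s - t) : Circle) : ℂ) - (Circle.exp t : ℂ) =
      (Circle.exp t : ℂ) * ((Circle.exp (s - t) : ℂ) - 1) := by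
    push_cast; ring
  rw [h3, norm_mul, Circle.norm_coe, one_mul, Circle.coe_exp, mul_comm ((s - t : ℝ) : ℂ)]
  exact Real.norm_exp_I_mul_ofReal_sub_one_le

theorem LipschitzWith.angleLipschitz {K : NNReal} {f : Circle → ℝ} (h : LipschitzWith K f) :
    AngleLipschitz K f := fun s t => by
  rw [← Real.dist_eq]
  exact (h.dist_le_mul _ _).trans (mul_le_mul_of_nonneg_left (dist_exp_le s t) K.2)

theorem exists_exp_eq_abs_sub_le (x y : Circle) :
    ∃ s t : ℝ, Circle.exp s = x ∧ Circle.exp t = y ∧ |s - t| ≤ Real.pi / 2 * dist x y := by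
  refine ⟨Complex.arg y + Complex.arg ((x / y : Circle) : ℂ), Complex.arg y, ?_, Circle.exp_arg y,
    ?_⟩
  · rw [Circle.exp_add, Circle.exp_arg, Circle.exp_arg]
    exact mul_div_cancel y x
  · rw [add_sub_cancel_left, Circle.coe_div,
      ← Complex.angle_eq_abs_arg (Circle.coe_ne_zero x) (Circle.coe_ne_zero y)]
    have h : dist x y = ‖(x : ℂ) - (y : ℂ)‖ := by rw [← Complex.dist_eq]; rfl
    rw [h]
    exact Complex.angle_le_mul_norm_sub (Circle.norm_coe x) (Circle.norm_coe y)

theorem AngleLipschitz.lipschitzWith {L : NNReal} {f : Circle → ℝ} (h : AngleLipschitz L f) :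
    LipschitzWith (L * (Real.pi / 2).toNNReal) f := by
  refine LipschitzWith.of_dist_le_mul fun x y => ?_
  obtain ⟨s, t, rfl, rfl, hst⟩ := exists_exp_eq_abs_sub_le x y
  rw [Real.dist_eq]
  refine (h s t).trans ?_
  rw [NNReal.coe_mul, Real.coe_toNNReal _ (by positivity), mul_assoc]
  exact mul_le_mul_of_nonneg_left hst L.2

/-- Doeblin–Fortet inequality. Each branch contracts angles by `1/N`. The variation of `f` is
averaged with weights summing to `1`; the variation of `W` contributes `K/N` from each of `N`
branches. -/
theorem AngleLipschitz.ruelleLin {N : ℕ} (hN : N ≠ 0) {W : C(Circle, ℝ)} (hW : ∀ z, 0 ≤ W z)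
    (h1 : ∀ x, ruelle N W (fun _ => 1) x = 1) {K L : ℝ}
    (hK : AngleLipschitz K W) {f : C(Circle, ℝ)} (hL : AngleLipschitz L f) :
    AngleLipschitz (L / N + K * ‖f‖) (ruelleLin hN W f) := by
  have hN' : (N : ℝ) ≠ 0 := Nat.cast_ne_zero.2 hN
  intro s t
  have hsum := h1 (Circle.exp s)
  rw [ruelle_exp hN] at hsum
  simp only [mul_one] at hsum
  rw [ruelleLin_apply, ruelleLin_apply, ruelle_exp hN, ruelle_exp hN, ← Finset.sum_sub_distrib]
  have hd : ∀ k : ℕ, |(s + 2 * Real.pi * k) / N - (t + 2 * Real.pi * k) / N| = |s - t| / N := by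
    intro k
    rw [← sub_div, abs_div, Nat.abs_cast]
    congr 2
    ring
  have key : ∀ k ∈ Finset.range N, |W (rootBranch N s k) * f (rootBranch N s k) -
      W (rootBranch N t k) * f (rootBranch N t k)| ≤
      W (rootBranch N s k) * (L * (|s - t| / N)) + K * (|s - t| / N) * ‖f‖ := by
    intro k _
    have e : W (rootBranch N s k) * f (rootBranch N s k) -
      W (rootBranch N t k) * f (rootBranch N t k) =
      W (rootBranch N s k) * (f (rootBranch N s k) - f (rootBranch N t k)) +
      (W (rootBranch N s k) - W (rootBranch N t k)) * f (rootBranch N t k) := by ring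
    rw [e]
    refine (abs_add_le _ _).trans (add_le_add ?_ ?_)
    · rw [abs_mul, abs_of_nonneg (hW _)]
      refine mul_le_mul_of_nonneg_left ?_ (hW _)
      rw [← hd k]
      exact hL _ _
    · rw [abs_mul]
      refine mul_le_mul ?_ (f.norm_coe_le_norm _) (abs_nonneg _) ?_
      · rw [← hd k]
        exact hK _ _
      · rw [← hd k]
        exact (abs_nonneg _).trans (hK _ _)
  refine (Finset.abs_sum_le_sum_abs _ _).trans ((Finset.sum_le_sum key).trans ?_)
  rw [Finset.sum_add_distrib, ← Finset.sum_mul, hsum, Finset.sum_const, Finset.card_range,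
    nsmul_eq_mul]
  apply le_of_eq
  field_simp

theorem AngleLipschitz.mono {L L' : ℝ} (h : L ≤ L') {f : Circle → ℝ} (hf : AngleLipschitz L f) :
    AngleLipschitz L' f := fun s t =>
  (hf s t).trans (mul_le_mul_of_nonneg_right h (abs_nonneg _))

/-- The bound `M = max L (2K‖f‖)` reproduces itself: `M/N + K‖f‖ ≤ M/2 + M/2`. -/
theorem AngleLipschitz.ruelleLin_pow {N : ℕ} (hN2 : 2 ≤ N) (hN : N ≠ 0) {W : C(Circle, ℝ)}
    (hW : ∀ z, 0 ≤ W z) (h1 : ∀ x, ruelle N W (fun _ => 1) x = 1) {K L : ℝ} (hK0 : 0 ≤ K)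
    (hK : AngleLipschitz K W) {f : C(Circle, ℝ)} (hL : AngleLipschitz L f) (k : ℕ) :
    AngleLipschitz (max L (2 * K * ‖f‖)) ((_root_.ruelleLin hN W ^ k) f) := by
  have hM0 : 0 ≤ max L (2 * K * ‖f‖) := le_max_of_le_right (by positivity)
  induction k with
  | zero => exact hL.mono (le_max_left _ _)
  | succ k ih =>
    rw [pow_succ', Module.End.mul_apply]
    refine (AngleLipschitz.ruelleLin hN hW h1 hK ih).mono ?_
    have h2 : (2 : ℝ) ≤ N := by exact_mod_cast hN2
    have h3 : max L (2 * K * ‖f‖) / N ≤ max L (2 * K * ‖f‖) / 2 :=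
      div_le_div_of_nonneg_left hM0 two_pos h2
    have h4 := mul_le_mul_of_nonneg_left (norm_ruelleLin_pow_le hN hW h1 f k) hK0
    have h5 := le_max_right L (2 * K * ‖f‖)
    linarith

/-! ### Rigidity of closed backward invariant sets -/

theorem iterate_circle_pow (N n : ℕ) (z : Circle) :
    (fun z : Circle => z ^ N)^[n] z = z ^ N ^ n := by
  induction n generalizing z with
  | zero => simp
  | succ n ih => rw [Function.iterate_succ_apply, ih, ← pow_mul, pow_succ']

theorem pow_pow_mul_eq_self {N p : ℕ} {u : Circle} (hu : u ^ N ^ p = u) (q : ℕ) :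
    u ^ N ^ (p * q) = u := by
  induction q with
  | zero => simp
  | succ q ih => rw [mul_add, mul_one, pow_add, pow_mul, ih, hu]

theorem dense_setOf_pow_eq {N : ℕ} (hN : 2 ≤ N) (y : Circle) :
    Dense {w : Circle | ∃ n : ℕ, w ^ N ^ n = y} := by
  rw [Metric.dense_iff]
  intro u r hr
  obtain ⟨s, rfl⟩ := Circle.exp_surjective u
  obtain ⟨t, rfl⟩ := Circle.exp_surjective y
  obtain ⟨n, hn⟩ := exists_nat_gt (2 * Real.pi / r)
  have hNn : (n : ℝ) < (N : ℝ) ^ n := by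
    exact_mod_cast n.lt_pow_self (by omega)
  have hM : 0 < (N : ℝ) ^ n := lt_of_le_of_lt n.cast_nonneg hNn
  set M : ℝ := (N : ℝ) ^ n with hMdef
  -- The `N ^ n`-th roots of `exp t` are spaced `2π / N ^ n < r` apart; `k` picks the last one at or
  -- before the angle `s`.
  set k : ℤ := ⌊(s * M - t) / (2 * Real.pi)⌋
  have hpi := Real.two_pi_pos
  have h1 := Int.floor_le ((s * M - t) / (2 * Real.pi))
  have h2 := Int.lt_floor_add_one ((s * M - t) / (2 * Real.pi))
  rw [le_div_iff₀ hpi] at h1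
  rw [div_lt_iff₀ hpi] at h2
  refine ⟨Circle.exp ((t + k * (2 * Real.pi)) / M), ?_, n, ?_⟩
  · rw [Metric.mem_ball]
    refine (dist_exp_le _ _).trans_lt ?_
    have e : (t + k * (2 * Real.pi)) / M - s = -((s * M - (t + k * (2 * Real.pi))) / M) := by
      field_simp
      ring
    rw [e, abs_neg, abs_of_nonneg (div_nonneg (by linarith) hM.le), div_lt_iff₀ hM]
    rw [div_lt_iff₀ hr] at hn
    nlinarith
  · rw [← Circle.exp_natCast_mul, Circle.exp_eq_exp]
    refine ⟨k, ?_⟩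
    push_cast
    rw [← hMdef]
    field_simp

/-- A set is backward invariant for the weight `W` if it contains the preimages of its points
under `z ↦ z ^ N` at which `W` does not vanish. -/
def BackwardInvariant (N : ℕ) (W : Circle → ℝ) (E : Set Circle) : Prop :=
  ∀ y : Circle, y ^ N ∈ E → W y ≠ 0 → y ∈ E

namespace IsAdmissibleWeight

variable {N : ℕ} {W : Circle → ℝ}

theorem continuous (h : IsAdmissibleWeight N W) : Continuous W :=
  h.lipschitz.choose_spec.continuous

theorem sum_rootSet (h : IsAdmissibleWeight N W) (hN : N ≠ 0) (x : Circle) :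
    ∑ y ∈ rootSet hN x, W y = 1 := by
  have := h.ruelle_one x
  rw [ruelle_eq_sum hN] at this
  simpa using this

theorem exists_root (h : IsAdmissibleWeight N W) (hN : N ≠ 0) (x : Circle) :
    ∃ y, y ^ N = x ∧ W y ≠ 0 := by
  by_contra! hc
  have := h.sum_rootSet hN x
  rw [Finset.sum_eq_zero fun y hy => hc y ((mem_rootSet hN x y).1 hy)] at this
  exact zero_ne_one this

theorem exists_backward_orbit (h : IsAdmissibleWeight N W) (hN : N ≠ 0) {E : Set Circle}
    (hE : BackwardInvariant N W E) {x : Circle} (hx : x ∈ E) (c : ℕ) :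
    ∃ y ∈ E, y ^ N ^ c = x := by
  induction c with
  | zero => exact ⟨x, hx, by simp⟩
  | succ c ih =>
    obtain ⟨y, hy, rfl⟩ := ih
    obtain ⟨z, rfl, hz⟩ := h.exists_root hN y
    exact ⟨z, hE z hy hz, by rw [← pow_mul, pow_succ']⟩

/-- A non-periodic `x` is hit at most once by each forward orbit, so the finitely many zeros of `W`
block only bounded depths of its backward tree. Beyond that depth a point of `E` has its whole
backward tree in `E`, and this tree is dense. -/
theorem eq_univ_of_not_periodic (h : IsAdmissibleWeight N W) (hN : 2 ≤ N) {E : Set Circle}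
    (hcl : IsClosed E) (hE : BackwardInvariant N W E) {x : Circle} (hx : x ∈ E)
    (hper : ∀ n : ℕ, 0 < n → x ^ N ^ n ≠ x) : E = Set.univ := by
  have hN0 : N ≠ 0 := by omega
  have huniq : ∀ z : Circle, ∃ b : ℕ, ∀ n, z ^ N ^ n = x → n < b := by
    intro z
    by_cases hz : ∃ n, z ^ N ^ n = x
    · obtain ⟨a, ha⟩ := hz
      refine ⟨a + 1, fun n hn => ?_⟩
      by_contra hlt
      refine hper (n - a) (by omega) ?_
      conv_lhs => rw [← ha]
      rw [← pow_mul, ← pow_add, Nat.add_sub_cancel' (by omega), hn]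
    · exact ⟨0, fun n hn => absurd ⟨n, hn⟩ hz⟩
  choose b hb using huniq
  -- Every zero that reaches `x` does so in fewer than `c` steps; one lying `k` steps above `y`
  -- would need `k + c`.
  obtain ⟨c, hc⟩ := (h.finite_zeros.image b).bddAbove
  obtain ⟨y, hyE, hyx⟩ := h.exists_backward_orbit hN0 hE hx c
  have hfree : ∀ (k : ℕ) (z : Circle), z ^ N ^ k = y → W z ≠ 0 := by
    intro k z hz h0
    have h1 : b z ≤ c := hc ⟨z, h0, rfl⟩
    have h2 := hb z (k + c) (by rw [pow_add, pow_mul, hz, hyx])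
    omega
  have hmem : ∀ (k : ℕ) (z : Circle), z ^ N ^ k = y → z ∈ E := by
    intro k
    induction k with
    | zero => intro z hz; simpa [← hz] using hyE
    | succ k ih =>
      intro z hz
      refine hE z (ih _ ?_) (hfree _ z hz)
      rw [← pow_mul, ← pow_succ', hz]
  have hd : Dense E := (dense_setOf_pow_eq hN y).mono (by rintro w ⟨n, hw⟩; exact hmem n w hw)
  rw [← hcl.closure_eq, hd.closure_eq]

/-- If all points of `E` were periodic, `r` would be injective on `E`. Each point of `E` would then
have a single preimage of nonzero weight, of weight `1` since `R_W 1 = 1`, and this produces a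
`W`-cycle. -/
theorem exists_not_periodic (h : IsAdmissibleWeight N W) (hN : 2 ≤ N) {E : Set Circle}
    (hne : E.Nonempty) (hE : BackwardInvariant N W E) :
    ∃ x ∈ E, ∀ n : ℕ, 0 < n → x ^ N ^ n ≠ x := by
  by_contra! hc
  have hN0 : N ≠ 0 := by omega
  have hinj : ∀ y ∈ E, ∀ z ∈ E, y ^ N = z ^ N → y = z := by
    intro y hy z hz hyz
    obtain ⟨m, hm, hm'⟩ := hc y hy
    obtain ⟨n, hn, hn'⟩ := hc z hz
    have h1 := pow_pow_mul_eq_self hm' n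
    have h2 := pow_pow_mul_eq_self hn' m
    rw [mul_comm n m] at h2
    obtain ⟨p, hp⟩ : ∃ p, m * n = p + 1 := ⟨m * n - 1, by have := Nat.mul_pos hm hn; omega⟩
    rw [hp, pow_succ', pow_mul] at h1 h2
    rw [← h1, ← h2, hyz]
  have hstep : ∀ x ∈ E, ∃ y ∈ E, y ^ N = x ∧ W y = 1 := by
    intro x hx
    obtain ⟨y, hy, hWy⟩ := h.exists_root hN0 x
    have hyE : y ∈ E := hE y (hy ▸ hx) hWy
    refine ⟨y, hyE, hy, ?_⟩
    rw [← h.sum_rootSet hN0 x]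
    refine (Finset.sum_eq_single_of_mem y ((mem_rootSet hN0 x y).2 hy) fun z hz hzy => ?_).symm
    rw [mem_rootSet] at hz
    by_contra hWz
    exact hzy (hinj z (hE z (hz ▸ hx) hWz) y hyE (hz.trans hy.symm))
  have hchain : ∀ x ∈ E, ∀ c : ℕ, ∃ y ∈ E, y ^ N ^ c = x ∧ ∀ k < c, W (y ^ N ^ k) = 1 := by
    intro x hx c
    induction c with
    | zero => exact ⟨x, hx, by simp, by simp⟩
    | succ c ih =>
      obtain ⟨y, hyE, hyx, hy⟩ := ih
      obtain ⟨z, hzE, rfl, hz⟩ := hstep y hyE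
      refine ⟨z, hzE, by rw [pow_succ', pow_mul, hyx], fun k hk => ?_⟩
      cases k with
      | zero => simpa using hz
      | succ k =>
        rw [pow_succ', pow_mul]
        exact hy k (by omega)
  obtain ⟨x, hx⟩ := hne
  obtain ⟨n, hn, hnx⟩ := hc x hx
  refine h.no_cycle x ⟨⟨n, hn, by rw [iterate_circle_pow, hnx]⟩, fun k => ?_⟩
  -- Going back a multiple of the period `n` of `x`, and more than `k` steps, leads to `x` itself,
  -- because `y` is periodic too; so `W = 1` at the `k`-th iterate.
  obtain ⟨y, hyE, hyx, hy⟩ := hchain x hx (n * (k + 1))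
  have hxy : x = y := by
    obtain ⟨m, hm, hmy⟩ := hc y hyE
    obtain ⟨p, rfl⟩ : ∃ p, m = p + 1 := ⟨m - 1, by omega⟩
    have h1 := pow_pow_mul_eq_self hmy (n * (k + 1))
    rw [add_one_mul, add_comm, pow_add, pow_mul, hyx,
      show p * (n * (k + 1)) = n * (p * (k + 1)) by ring, pow_pow_mul_eq_self hnx] at h1
    exact h1
  rw [iterate_circle_pow, hxy]
  exact hy k (by nlinarith)

theorem backwardInvariant_eq_univ (h : IsAdmissibleWeight N W) (hN : 2 ≤ N) {E : Set Circle}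
    (hcl : IsClosed E) (hne : E.Nonempty) (hE : BackwardInvariant N W E) : E = Set.univ := by
  obtain ⟨x, hx, hper⟩ := h.exists_not_periodic hN hne hE
  exact h.eq_univ_of_not_periodic hN hcl hE hx hper

/-- Maximum principle: at a maximum, `g` is a weighted average of its values on the fibre, so those
with nonzero weight are maximal too. The set of maxima is thus backward invariant. -/
theorem eq_of_ruelle_eq_self (h : IsAdmissibleWeight N W) (hN : 2 ≤ N) {g : Circle → ℝ}
    (hg : Continuous g) (hfix : ∀ x, ruelle N W g x = g x) (x y : Circle) : g x = g y := by
  have hN0 : N ≠ 0 := by omega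
  obtain ⟨z, -, hz⟩ := isCompact_univ.exists_isMaxOn Set.univ_nonempty hg.continuousOn
  have hmax : ∀ w, g w ≤ g z := fun w => hz (Set.mem_univ w)
  have hE : {w | g w = g z} = Set.univ := by
    refine h.backwardInvariant_eq_univ hN (isClosed_eq hg continuous_const) ⟨z, rfl⟩ ?_
    intro w hw hWw
    change g (w ^ N) = g z at hw
    by_contra hne
    have hlt : g w < g z := lt_of_le_of_ne (hmax w) hne
    have h1 := hfix (w ^ N)
    rw [ruelle_eq_sum hN0, hw] at h1
    have h2 : ∑ v ∈ rootSet hN0 (w ^ N), W v * g v < ∑ v ∈ rootSet hN0 (w ^ N), W v * g z :=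
      Finset.sum_lt_sum (fun v _ => mul_le_mul_of_nonneg_left (hmax v) (h.nonneg v))
        ⟨w, by simp, mul_lt_mul_of_pos_left hlt (lt_of_le_of_ne (h.nonneg w) (Ne.symm hWw))⟩
    rw [← Finset.sum_mul, h.sum_rootSet, h1, one_mul] at h2
    exact h2.false
  have hall : ∀ w, g w = g z := fun w => by
    have : w ∈ {w | g w = g z} := hE ▸ Set.mem_univ w
    exact this
  rw [hall x, hall y]

end IsAdmissibleWeight

/-! ### Measures as limits of functionals, and compactness -/

theorem exists_probabilityMeasure_of_tendsto {ι : Type*} {l : Filter ι} [l.NeBot]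
    (T : ι → C(Circle, ℝ) →ₗ[ℝ] ℝ) (hpos : ∀ i f, 0 ≤ f → 0 ≤ T i f) (hone : ∀ i, T i 1 = 1)
    (hconv : ∀ f, ∃ a, Tendsto (fun i => T i f) l (𝓝 a)) :
    ∃ ν : Measure Circle, IsProbabilityMeasure ν ∧
      ∀ f : C(Circle, ℝ), Tendsto (fun i => T i f) l (𝓝 (∫ x, f x ∂ν)) := by
  choose Λ hΛ using hconv
  -- Linearity and positivity pass to the pointwise limit, to which Riesz–Markov–Kakutani applies.
  -- The filter is left general: it is an ultrafilter for invariant measures and `atTop` for the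
  -- Riesz product.
  let Λ' : CompactlySupportedContinuousMap Circle ℝ →ₚ[ℝ] ℝ := PositiveLinearMap.mk₀
    { toFun := fun f => Λ f.toContinuousMap
      map_add' := fun f g => tendsto_nhds_unique (hΛ _) (by
        have h : (f + g).toContinuousMap = f.toContinuousMap + g.toContinuousMap := rfl
        simpa only [h, map_add] using (hΛ _).add (hΛ _))
      map_smul' := fun c f => tendsto_nhds_unique (hΛ _) (by
        have h : (c • f).toContinuousMap = c • f.toContinuousMap := rfl
        simpa only [h, map_smul, smul_eq_mul, RingHom.id_apply] using (hΛ f.toContinuousMap).const_mul c) }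
    (fun f hf => ge_of_tendsto' (hΛ _) fun i => hpos i _ hf)
  have hint : ∀ f : C(Circle, ℝ), ∫ x, f x ∂(RealRMK.rieszMeasure Λ') = Λ f := fun f =>
    RealRMK.integral_rieszMeasure Λ' (CompactlySupportedContinuousMap.continuousMapEquiv f)
  refine ⟨RealRMK.rieszMeasure Λ', ?_, fun f => by rw [hint]; exact hΛ f⟩
  have h1 := hint 1
  have h2 : Λ 1 = 1 := tendsto_nhds_unique (hΛ 1) (by simp only [hone]; exact tendsto_const_nhds)
  rw [h2] at h1
  simp only [ContinuousMap.one_apply, integral_const, smul_eq_mul, mul_one] at h1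
  refine ⟨?_⟩
  rw [Measure.real] at h1
  rw [← ENNReal.toReal_eq_one_iff, h1]

/-- Thickened indicators are Lipschitz and decrease to indicators of closed sets, which form a
generating π-system. -/
theorem measure_ext_of_angleLipschitz {μ ν : Measure Circle} [IsProbabilityMeasure μ]
    [IsProbabilityMeasure ν]
    (h : ∀ (L : ℝ) (f : C(Circle, ℝ)), AngleLipschitz L f → ∫ x, f x ∂μ = ∫ x, f x ∂ν) :
    μ = ν := by
  refine ext_of_generate_finite _ (BorelSpace.measurable_eq.trans borel_eq_generateFrom_isClosed)
    isPiSystem_isClosed (fun F hF => ?_) (by simp)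
  have hδ : ∀ n : ℕ, (0 : ℝ) < 1 / ((n : ℝ) + 1) := fun n => Nat.one_div_pos_of_nat
  have h1 := tendsto_integral_thickenedIndicator_of_isClosed μ hF hδ
    tendsto_one_div_add_atTop_nhds_zero_nat
  have h2 := tendsto_integral_thickenedIndicator_of_isClosed ν hF hδ
    tendsto_one_div_add_atTop_nhds_zero_nat
  have h3 : μ.real F = ν.real F := by
    refine tendsto_nhds_unique h1 (h2.congr fun n => ?_)
    have hl := lipschitzWith_thickenedIndicator (hδ n) F
    have hl' : LipschitzWith _ fun x => ((thickenedIndicator (hδ n) F x : NNReal) : ℝ) :=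
      (LipschitzWith.of_dist_le_mul fun x y => hl.dist_le_mul x y)
    exact (h _ ⟨_, hl'.continuous⟩ (LipschitzWith.angleLipschitz hl')).symm
  exact (measureReal_eq_measureReal_iff).1 h3

theorem exists_subseq_tendsto_of_angleLipschitz (F : ℕ → C(Circle, ℝ)) {L B : ℝ} (hL0 : 0 ≤ L)
    (hL : ∀ n, AngleLipschitz L (F n)) (hB : ∀ n, ‖F n‖ ≤ B) :
    ∃ φ : ℕ → ℕ, StrictMono φ ∧ ∃ g : C(Circle, ℝ),
      ∀ x, Tendsto (fun n => F (φ n) x) atTop (𝓝 (g x)) := by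
  lift L to NNReal using hL0
  let G : ℕ → BoundedContinuousFunction Circle ℝ := fun n =>
    BoundedContinuousFunction.mkOfCompact (F n)
  have hcpt : IsCompact (closure (Set.range G)) := by
    refine BoundedContinuousFunction.arzela_ascoli (Set.Icc (-B) B) isCompact_Icc _ ?_ ?_
    · rintro f x ⟨n, rfl⟩
      exact abs_le.1 (((F n).norm_coe_le_norm x).trans (hB n))
    · refine (LipschitzWith.uniformEquicontinuous _ (L * (Real.pi / 2).toNNReal)
        ?_).equicontinuous
      rintro ⟨_, n, rfl⟩
      exact (hL n).lipschitzWith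
  obtain ⟨g, -, φ, hφ, hg⟩ := hcpt.tendsto_subseq fun n => subset_closure (Set.mem_range_self n)
  exact ⟨φ, hφ, g.toContinuousMap, fun x =>
    ((BoundedContinuousFunction.lipschitz_eval_const x).continuous.tendsto g).comp hg⟩

/-! ### Cesàro averages; existence and uniqueness of the invariant measure -/

/-- The Cesàro averages of the powers of the Ruelle operator. -/
def ruelleCesaro {N : ℕ} (hN : N ≠ 0) (W : C(Circle, ℝ)) (n : ℕ) :
    C(Circle, ℝ) →ₗ[ℝ] C(Circle, ℝ) :=
  ((n : ℝ) + 1)⁻¹ • ∑ k ∈ Finset.range (n + 1), ruelleLin hN W ^ k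

section Cesaro

variable {N : ℕ} (hN : N ≠ 0) (W : C(Circle, ℝ))

theorem ruelleCesaro_apply (n : ℕ) (f : C(Circle, ℝ)) (x : Circle) :
    ruelleCesaro hN W n f x =
      ((n : ℝ) + 1)⁻¹ * ∑ k ∈ Finset.range (n + 1), (ruelleLin hN W ^ k) f x := by
  simp [ruelleCesaro, LinearMap.sum_apply]

theorem ruelleCesaro_ruelleLin (n : ℕ) (f : C(Circle, ℝ)) (x : Circle) :
    ruelleCesaro hN W n (ruelleLin hN W f) x - ruelleCesaro hN W n f x =
      ((n : ℝ) + 1)⁻¹ * ((ruelleLin hN W ^ (n + 1)) f x - f x) := by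
  rw [ruelleCesaro_apply, ruelleCesaro_apply, ← mul_sub, ← Finset.sum_sub_distrib]
  congr 1
  have : ∀ k, (ruelleLin hN W ^ k) (ruelleLin hN W f) = (ruelleLin hN W ^ (k + 1)) f := by
    intro k
    rw [pow_succ, Module.End.mul_apply]
  simp only [this]
  rw [Finset.sum_range_sub (fun k => (ruelleLin hN W ^ k) f x)]
  simp

theorem ruelleLin_ruelleCesaro (n : ℕ) (f : C(Circle, ℝ)) :
    ruelleLin hN W (ruelleCesaro hN W n f) = ruelleCesaro hN W n (ruelleLin hN W f) := by
  simp only [ruelleCesaro, LinearMap.smul_apply, map_smul, LinearMap.sum_apply, map_sum]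
  congr 1
  refine Finset.sum_congr rfl fun k _ => ?_
  rw [← Module.End.mul_apply, ← Module.End.mul_apply, ← pow_succ, pow_succ']

variable {W}

theorem tendsto_ruelleCesaro_ruelleLin_sub (hW : ∀ z, 0 ≤ W z)
    (h1 : ∀ x, ruelle N W (fun _ => 1) x = 1) (f : C(Circle, ℝ)) (x : Circle) :
    Tendsto (fun n => ruelleCesaro hN W n (ruelleLin hN W f) x - ruelleCesaro hN W n f x)
      atTop (𝓝 0) := by
  refine squeeze_zero_norm (a := fun n : ℕ => 1 / ((n : ℝ) + 1) * (2 * ‖f‖)) (fun n => ?_) ?_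
  · rw [ruelleCesaro_ruelleLin, norm_mul, norm_inv, one_div]
    have : ‖(n : ℝ) + 1‖ = n + 1 := by
      rw [Real.norm_eq_abs, abs_of_pos]
      positivity
    rw [this]
    refine mul_le_mul_of_nonneg_left ?_ (by positivity)
    have h3 := (ContinuousMap.norm_coe_le_norm ((ruelleLin hN W ^ (n + 1)) f) x).trans
      (norm_ruelleLin_pow_le hN hW h1 f _)
    have h4 := f.norm_coe_le_norm x
    exact (norm_sub_le _ _).trans (by linarith)
  · simpa using tendsto_one_div_add_atTop_nhds_zero_nat.mul_const (2 * ‖f‖)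

theorem ruelleLin_pow_nonneg (hW : ∀ z, 0 ≤ W z) (k : ℕ) {f : C(Circle, ℝ)} (hf : 0 ≤ f) :
    0 ≤ (ruelleLin hN W ^ k) f := by
  induction k with
  | zero => simpa
  | succ k ih =>
    rw [pow_succ', Module.End.mul_apply]
    intro x
    change 0 ≤ ruelle N W _ x
    rw [ruelle_eq_sum hN]
    exact Finset.sum_nonneg fun y _ => mul_nonneg (hW y) (ih y)

theorem ruelleLin_pow_one (h1 : ∀ x, ruelle N W (fun _ => 1) x = 1) (k : ℕ) : (ruelleLin hN W ^ k) 1 = 1 := by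
  induction k with
  | zero => simp
  | succ k ih =>
    rw [pow_succ', Module.End.mul_apply, ih]
    ext x
    exact h1 x

theorem abs_ruelleCesaro_le (hW : ∀ z, 0 ≤ W z)
    (h1 : ∀ x, ruelle N W (fun _ => 1) x = 1) (n : ℕ) (f : C(Circle, ℝ)) (x : Circle) :
    |ruelleCesaro hN W n f x| ≤ ‖f‖ := by
  rw [ruelleCesaro_apply, abs_mul, abs_of_pos (by positivity : (0 : ℝ) < ((n : ℝ) + 1)⁻¹),
    inv_mul_le_iff₀ (by positivity)]
  refine (Finset.abs_sum_le_sum_abs _ _).trans ((Finset.sum_le_sum fun k _ =>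
    (ContinuousMap.norm_coe_le_norm _ x).trans (norm_ruelleLin_pow_le hN hW h1 f k)).trans ?_)
  simp

theorem AngleLipschitz.ruelleCesaro (hW : ∀ z, 0 ≤ W z)
    (h1 : ∀ x, ruelle N W (fun _ => 1) x = 1) (hN2 : 2 ≤ N) {K L : ℝ} (hK0 : 0 ≤ K)
    (hK : AngleLipschitz K W) {f : C(Circle, ℝ)} (hL : AngleLipschitz L f) (n : ℕ) :
    AngleLipschitz (max L (2 * K * ‖f‖)) (ruelleCesaro hN W n f) := by
  intro s t
  rw [ruelleCesaro_apply, ruelleCesaro_apply, ← mul_sub, abs_mul,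
    abs_of_pos (by positivity : (0 : ℝ) < ((n : ℝ) + 1)⁻¹), inv_mul_le_iff₀ (by positivity),
    ← Finset.sum_sub_distrib]
  refine (Finset.abs_sum_le_sum_abs _ _).trans ((Finset.sum_le_sum fun k _ =>
    AngleLipschitz.ruelleLin_pow hN2 hN hW h1 hK0 hK hL k s t).trans ?_)
  simp

theorem integral_ruelleCesaro {ν : Measure Circle} (hν : IsInvariantMeasure N W ν) (n : ℕ)
    (f : C(Circle, ℝ)) : ∫ x, ruelleCesaro hN W n f x ∂ν = ∫ x, f x ∂ν := by
  have := hν.1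
  have hk : ∀ k : ℕ, ∫ x, (ruelleLin hN W ^ k) f x ∂ν = ∫ x, f x ∂ν := by
    intro k
    induction k with
    | zero => simp
    | succ k ih =>
      rw [pow_succ', Module.End.mul_apply, ← ih]
      exact hν.2 _
  have hint : ∀ g : C(Circle, ℝ), Integrable g ν := fun g =>
    g.continuous.integrable_of_hasCompactSupport (HasCompactSupport.of_compactSpace g)
  simp only [ruelleCesaro_apply]
  rw [integral_const_mul, integral_finsetSum _ fun k _ => hint _]
  simp only [hk, Finset.sum_const, Finset.card_range, nsmul_eq_mul]
  push_cast
  field_simp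

end Cesaro

namespace IsAdmissibleWeight

variable {N : ℕ} {W : Circle → ℝ}

/-- An admissible weight as a continuous function. -/
def toContinuousMap (h : IsAdmissibleWeight N W) : C(Circle, ℝ) := ⟨W, h.continuous⟩

/-- The averages are bounded and equi-Lipschitz, and applying `R_W` changes them by a telescoping
error of order `1/n`; a subsequential limit is therefore fixed by `R_W`, hence constant. -/
theorem exists_tendsto_ruelleCesaro (h : IsAdmissibleWeight N W) (hN2 : 2 ≤ N) (hN : N ≠ 0)
    {L : ℝ} {f : C(Circle, ℝ)} (hf : AngleLipschitz L f) :
    ∃ φ : ℕ → ℕ, StrictMono φ ∧ ∃ c : ℝ, ∀ x,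
      Tendsto (fun n => ruelleCesaro hN h.toContinuousMap (φ n) f x) atTop (𝓝 c) := by
  obtain ⟨K, hK⟩ := h.lipschitz
  have hW : ∀ z, 0 ≤ h.toContinuousMap z := h.nonneg
  have h1 : ∀ x, ruelle N h.toContinuousMap (fun _ => 1) x = 1 := h.ruelle_one
  obtain ⟨φ, hφ, g, hg⟩ := exists_subseq_tendsto_of_angleLipschitz
    (fun n => ruelleCesaro hN h.toContinuousMap n f) (le_max_of_le_right (mul_nonneg (mul_nonneg two_pos.le K.2) (norm_nonneg f)))
    (AngleLipschitz.ruelleCesaro hN hW h1 hN2 K.2 hK.angleLipschitz hf)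
    (fun n => (ContinuousMap.norm_le _ (norm_nonneg f)).2 fun x =>
      abs_ruelleCesaro_le hN hW h1 n f x)
  refine ⟨φ, hφ, g 1, fun x => ?_⟩
  have hfix : ∀ x, ruelle N W g x = g x := by
    intro x
    have e1 : Tendsto (fun n => ruelleLin hN h.toContinuousMap
        (ruelleCesaro hN h.toContinuousMap (φ n) f) x) atTop (𝓝 (ruelle N W g x)) := by
      simp only [ruelleLin_apply, ruelle_eq_sum hN]
      exact tendsto_finsetSum _ fun y _ => (hg y).const_mul _
    have e2 := ((tendsto_ruelleCesaro_ruelleLin_sub hN hW h1 f x).comp hφ.tendsto_atTop).add (hg x)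
    refine tendsto_nhds_unique e1 ?_
    simpa [ruelleLin_ruelleCesaro] using e2
  rw [← h.eq_of_ruelle_eq_self hN2 g.continuous hfix x 1]
  exact hg x

theorem invariantMeasure_unique (h : IsAdmissibleWeight N W) (hN2 : 2 ≤ N) {μ ν : Measure Circle}
    (hμ : IsInvariantMeasure N W μ) (hν : IsInvariantMeasure N W ν) : μ = ν := by
  have hN : N ≠ 0 := by omega
  have := hμ.1
  have := hν.1
  have hW : ∀ z, 0 ≤ h.toContinuousMap z := h.nonneg
  have h1 : ∀ x, ruelle N h.toContinuousMap (fun _ => 1) x = 1 := h.ruelle_one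
  refine measure_ext_of_angleLipschitz fun L f hf => ?_
  obtain ⟨φ, -, c, hc⟩ := h.exists_tendsto_ruelleCesaro hN2 hN hf
  have key : ∀ ρ : Measure Circle, IsInvariantMeasure N W ρ → ∫ x, f x ∂ρ = c := by
    intro ρ hρ
    have := hρ.1
    have h2 : Tendsto (fun n => ∫ x, ruelleCesaro hN h.toContinuousMap (φ n) f x ∂ρ) atTop
        (𝓝 (∫ _, c ∂ρ)) :=
      tendsto_integral_of_dominated_convergence (fun _ => ‖f‖)
        (fun n => (ContinuousMap.continuous _).aestronglyMeasurable) (integrable_const _)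
        (fun n => ae_of_all _ fun x => abs_ruelleCesaro_le hN hW h1 _ f x)
        (ae_of_all _ hc)
    simp only [integral_ruelleCesaro (W := h.toContinuousMap) hN hρ] at h2
    simpa using tendsto_nhds_unique tendsto_const_nhds h2
  rw [key μ hμ, key ν hν]

theorem exists_invariantMeasure (h : IsAdmissibleWeight N W) (hN2 : 2 ≤ N) :
    ∃ ν : Measure Circle, IsInvariantMeasure N W ν := by
  have hN : N ≠ 0 := by omega
  have hW : ∀ z, 0 ≤ h.toContinuousMap z := h.nonneg
  have h1 : ∀ x, ruelle N h.toContinuousMap (fun _ => 1) x = 1 := h.ruelle_one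
  let T : ℕ → C(Circle, ℝ) →ₗ[ℝ] ℝ := fun n =>
    { toFun := fun f => ruelleCesaro hN h.toContinuousMap n f 1
      map_add' := fun f g => by simp
      map_smul' := fun c f => by simp }
  have hT : ∀ n f, T n f = ruelleCesaro hN h.toContinuousMap n f 1 := fun _ _ => rfl
  -- Along an ultrafilter every bounded sequence converges, for all `f` at once; as it refines
  -- `atTop`, the telescoping error still vanishes.
  obtain ⟨ν, hν, hlim⟩ := exists_probabilityMeasure_of_tendsto (l := (hyperfilter ℕ : Filter ℕ)) T
    (fun n f hf => by
      rw [hT, ruelleCesaro_apply]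
      exact mul_nonneg (by positivity)
        (Finset.sum_nonneg fun k _ => ruelleLin_pow_nonneg hN hW k hf 1))
    (fun n => by
      rw [hT, ruelleCesaro_apply]
      simp only [ruelleLin_pow_one hN h1, ContinuousMap.one_apply, Finset.sum_const,
        Finset.card_range, nsmul_eq_mul, mul_one]
      push_cast
      field_simp)
    (fun f => by
      obtain ⟨a, -, ha⟩ := (isCompact_Icc (a := -‖f‖) (b := ‖f‖)).ultrafilter_le_nhds
        ((hyperfilter ℕ).map fun n => T n f) (by
          rw [le_principal_iff]
          exact Eventually.of_forall (f := hyperfilter ℕ) fun n =>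
            abs_le.1 (abs_ruelleCesaro_le hN hW h1 n f 1))
      exact ⟨a, ha⟩)
  refine ⟨ν, hν, fun f => ?_⟩
  have e1 := hlim (ruelleLin hN h.toContinuousMap f)
  have e2 := ((tendsto_ruelleCesaro_ruelleLin_sub hN hW h1 f 1).mono_left
    Nat.hyperfilter_le_atTop).add (hlim f)
  refine tendsto_nhds_unique e1 ?_
  simpa [hT] using e2

end IsAdmissibleWeight

/-! ### Full support; the measure determines the weight -/

theorem ContinuousMap.integrable_circle (f : C(Circle, ℝ)) (ν : Measure Circle)
    [IsFiniteMeasure ν] : Integrable f ν :=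
  f.continuous.integrable_of_hasCompactSupport (HasCompactSupport.of_compactSpace f)

theorem integrable_ruelle {N : ℕ} (hN : N ≠ 0) {W f : Circle → ℝ} (hW : Continuous W)
    (hf : Continuous f) (ν : Measure Circle) [IsFiniteMeasure ν] :
    Integrable (ruelle N W f) ν :=
  ContinuousMap.integrable_circle ⟨_, continuous_ruelle hN hW hf⟩ ν

theorem ruelle_comp_pow_mul {N : ℕ} (hN : N ≠ 0) (W f g : Circle → ℝ) (x : Circle) :
    ruelle N W (fun y => g (y ^ N) * f y) x = g x * ruelle N W f x := by
  rw [ruelle_eq_sum hN, ruelle_eq_sum hN, Finset.mul_sum]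
  refine Finset.sum_congr rfl fun y hy => ?_
  rw [(mem_rootSet hN x y).1 hy]
  ring

namespace IsAdmissibleWeight

variable {N : ℕ} {W : Circle → ℝ} {ν : Measure Circle}

/-- The support is backward invariant: if `ν` vanished near `y` with `W y ≠ 0`, a bump `f` at `y`
would have `∫ R_W f = ∫ f = 0`, although `R_W f > 0` near `y ^ N`. -/
theorem support_eq_univ (h : IsAdmissibleWeight N W) (hN : 2 ≤ N)
    (hν : IsInvariantMeasure N W ν) : ν.support = Set.univ := by
  have hN0 : N ≠ 0 := by omega
  have := hν.1
  refine h.backwardInvariant_eq_univ hN Measure.isClosed_support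
    (Measure.nonempty_support (IsProbabilityMeasure.ne_zero ν)) fun y hy hWy => ?_
  by_contra hsupp
  rw [Measure.notMem_support_iff_exists] at hsupp
  obtain ⟨U, hU, hU0⟩ := hsupp
  obtain ⟨ε, hε, hball⟩ := Metric.mem_nhds_iff.1 hU
  let f : C(Circle, ℝ) := ⟨fun z => max (ε - dist z y) 0, by fun_prop⟩
  have hf0 : ∀ z, 0 ≤ f z := fun z => le_max_right _ _
  have hfy : 0 < f y := by
    change 0 < max (ε - dist y y) 0
    simp [hε]
  have hint : ∫ z, f z ∂ν = 0 := by
    refine integral_eq_zero_of_ae ?_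
    have : ∀ᵐ z ∂ν, z ∉ U := by simpa [ae_iff] using hU0
    filter_upwards [this] with z hz
    refine max_eq_right ?_
    by_contra hlt
    exact hz (hball (by rw [Metric.mem_ball]; linarith))
  rw [← hν.2 f] at hint
  have hcont : Continuous (ruelle N W f) := continuous_ruelle hN0 h.continuous f.continuous
  have hnn : ∀ x, 0 ≤ ruelle N W f x := fun x => by
    rw [ruelle_eq_sum hN0]
    exact Finset.sum_nonneg fun z _ => mul_nonneg (h.nonneg z) (hf0 z)
  rw [integral_eq_zero_iff_of_nonneg hnn
    (ContinuousMap.integrable_circle ⟨_, hcont⟩ ν)] at hint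
  have hpos : 0 < ruelle N W f (y ^ N) := by
    rw [ruelle_eq_sum hN0]
    refine Finset.sum_pos' (fun z _ => mul_nonneg (h.nonneg z) (hf0 z)) ⟨y, by simp, ?_⟩
    exact mul_pos (lt_of_le_of_ne (h.nonneg y) (Ne.symm hWy)) hfy
  have hopen : {x | 0 < ruelle N W f x} ∈ 𝓝 (y ^ N) :=
    (isOpen_lt continuous_const hcont).mem_nhds hpos
  refine ((Measure.mem_support_iff_forall _).1 hy _ hopen).ne' ?_
  refine measure_mono_null (fun x hx => ?_) (ae_iff.1 hint)
  exact ne_of_gt hx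

theorem eq_of_isInvariantMeasure {W' : Circle → ℝ} (h : IsAdmissibleWeight N W)
    (h' : IsAdmissibleWeight N W') (hN : 2 ≤ N) (hν : IsInvariantMeasure N W ν)
    (hν' : IsInvariantMeasure N W' ν) : W = W' := by
  have hN0 : N ≠ 0 := by omega
  have := hν.1
  let D : C(Circle, ℝ) := h.toContinuousMap - h'.toContinuousMap
  have hD : ∀ z, D z = W z - W' z := fun _ => rfl
  -- Using `D` as both weight and function yields a sum of squares equal to `R_W D - R_{W'} D`,
  -- whose integral is zero.
  let G : C(Circle, ℝ) := ruelleLin hN0 D D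
  have hG : ∀ x, G x = ∑ y ∈ rootSet hN0 x, D y * D y := fun x => ruelle_eq_sum hN0 D D x
  have hG' : ∀ x, G x = ruelle N W D x - ruelle N W' D x := fun x => by
    rw [hG, ruelle_eq_sum hN0, ruelle_eq_sum hN0, ← Finset.sum_sub_distrib]
    exact Finset.sum_congr rfl fun y _ => by rw [hD]; ring
  have hGi : ∫ x, G x ∂ν = 0 := by
    simp only [hG']
    rw [integral_sub (integrable_ruelle hN0 h.continuous D.continuous ν)
      (integrable_ruelle hN0 h'.continuous D.continuous ν), hν.2, hν'.2,
      sub_self]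
  have hG0 : ∀ x, 0 ≤ G x := fun x => by
    rw [hG]
    exact Finset.sum_nonneg fun y _ => mul_self_nonneg _
  rw [integral_eq_zero_iff_of_nonneg hG0 (G.integrable_circle ν)] at hGi
  ext y
  by_contra hne
  have hpos : 0 < G (y ^ N) := by
    rw [hG]
    refine Finset.sum_pos' (fun z _ => mul_self_nonneg _) ⟨y, by simp, ?_⟩
    rw [hD]
    exact mul_self_pos.2 (sub_ne_zero.2 hne)
  have hsupp : y ^ N ∈ ν.support := h.support_eq_univ hN hν ▸ Set.mem_univ _
  have hopen : {x | 0 < G x} ∈ 𝓝 (y ^ N) :=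
    (isOpen_lt continuous_const G.continuous).mem_nhds hpos
  refine ((Measure.mem_support_iff_forall _).1 hsupp _ hopen).ne' ?_
  exact measure_mono_null (fun x hx => ne_of_gt hx) (ae_iff.1 hGi)

end IsAdmissibleWeight

/-! ### Duality with the power map, ergodicity and singularity -/

namespace IsInvariantMeasure

variable {N : ℕ} {W : Circle → ℝ} {ν : Measure Circle}

/-- Tested against continuous `g`, this is invariance applied to `(g ∘ r) f`, since `R_W ((g ∘ r) f)
= g · R_W f`. Equality as measures is what allows passing to measurable sets. -/
theorem map_withDensity (hN : N ≠ 0) (hW : Continuous W) (hW0 : ∀ z, 0 ≤ W z)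
    (hν : IsInvariantMeasure N W ν) {f : C(Circle, ℝ)} (hf : ∀ z, 0 ≤ f z) :
    (ν.withDensity fun x => ENNReal.ofReal (f x)).map (fun z => z ^ N) =
      ν.withDensity fun x => ENNReal.ofReal (ruelle N W f x) := by
  have := hν.1
  have hfin : ∀ g : C(Circle, ℝ), (∀ z, 0 ≤ g z) →
      IsFiniteMeasure (ν.withDensity fun x => ENNReal.ofReal (g x)) := fun g _ =>
    isFiniteMeasure_withDensity_ofReal (g.integrable_circle ν).2
  let Rf : C(Circle, ℝ) := ⟨ruelle N W f, continuous_ruelle hN hW f.continuous⟩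
  have hRf : ∀ x, 0 ≤ Rf x := fun x => by
    change 0 ≤ ruelle N W f x
    rw [ruelle_eq_sum hN]
    exact Finset.sum_nonneg fun y _ => mul_nonneg (hW0 y) (hf y)
  have i1 := hfin f hf
  have i2 : IsFiniteMeasure (ν.withDensity fun x => ENNReal.ofReal (ruelle N W f x)) :=
    hfin Rf hRf
  have hpow : Continuous fun z : Circle => z ^ N := continuous_pow N
  refine ext_of_forall_integral_eq_of_IsFiniteMeasure fun g => ?_
  have hden : ∀ (u : C(Circle, ℝ)), (∀ z, 0 ≤ u z) → ∀ v : Circle → ℝ,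
      ∫ x, v x ∂(ν.withDensity fun x => ENNReal.ofReal (u x)) = ∫ x, v x * u x ∂ν := by
    intro u hu v
    rw [integral_withDensity_eq_integral_toReal_smul
      (u.continuous.measurable.ennreal_ofReal) (ae_of_all _ fun _ => ENNReal.ofReal_lt_top)]
    refine integral_congr_ae (ae_of_all _ fun x => ?_)
    simp only [ENNReal.toReal_ofReal (hu x), smul_eq_mul, mul_comm]
  rw [integral_map hpow.aemeasurable g.continuous.aestronglyMeasurable, hden f hf]
  refine Eq.trans ?_ (hden Rf hRf g).symm
  have h1 := hν.2 ⟨fun y => g (y ^ N) * f y, by fun_prop⟩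
  refine h1.symm.trans (integral_congr_ae (ae_of_all _ fun x => ?_))
  exact ruelle_comp_pow_mul hN W f g x

theorem setIntegral_ruelle (h : IsAdmissibleWeight N W) (hN : N ≠ 0)
    (hν : IsInvariantMeasure N W ν) (f : C(Circle, ℝ)) {A : Set Circle} (hA : MeasurableSet A) :
    ∫ x in A, ruelle N W f x ∂ν = ∫ x in (fun z : Circle => z ^ N) ⁻¹' A, f x ∂ν := by
  have := hν.1
  have hpow : Measurable fun z : Circle => z ^ N := (continuous_pow N).measurable
  have hnn : ∀ g : C(Circle, ℝ), (∀ z, 0 ≤ g z) →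
      ∫ x in A, ruelle N W g x ∂ν = ∫ x in (fun z : Circle => z ^ N) ⁻¹' A, g x ∂ν := by
    intro g hg
    have h1 := congrArg (fun μ : Measure Circle => μ A)
      (hν.map_withDensity hN h.continuous h.nonneg hg)
    simp only [Measure.map_apply hpow hA, withDensity_apply _ hA,
      withDensity_apply _ (hpow hA)] at h1
    rw [integral_eq_lintegral_of_nonneg_ae, integral_eq_lintegral_of_nonneg_ae, h1]
    · exact ae_of_all _ hg
    · exact g.continuous.aestronglyMeasurable
    · refine ae_of_all _ fun x => ?_
      change 0 ≤ ruelle N W g x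
      rw [ruelle_eq_sum hN]
      exact Finset.sum_nonneg fun y _ => mul_nonneg (h.nonneg y) (hg y)
    · exact (continuous_ruelle hN h.continuous g.continuous).aestronglyMeasurable
  -- Adding `‖f‖` makes `f` non-negative; linearity removes it again.
  let c : C(Circle, ℝ) := ContinuousMap.const Circle ‖f‖
  have e1 := hnn (f + c) fun z => by
    have := (abs_le.1 (f.norm_coe_le_norm z)).1
    change 0 ≤ f z + ‖f‖
    linarith
  have e2 := hnn c fun z => norm_nonneg f
  have e3 : ∀ x, ruelle N W (f + c : C(Circle, ℝ)) x = ruelle N W f x + ruelle N W c x := fun x =>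
    congrArg (fun g : C(Circle, ℝ) => g x) (map_add (ruelleLin hN h.toContinuousMap) f c)
  simp only [e3, ContinuousMap.add_apply] at e1
  rw [integral_add (integrable_ruelle hN h.continuous f.continuous _)
      (integrable_ruelle hN h.continuous c.continuous _),
    integral_add (f.integrable_circle _) (c.integrable_circle _), e2] at e1
  exact add_right_cancel e1

theorem measurePreserving (h : IsAdmissibleWeight N W) (hN : N ≠ 0)
    (hν : IsInvariantMeasure N W ν) : MeasurePreserving (fun z : Circle => z ^ N) ν ν := by
  have := hν.1
  refine ⟨(continuous_pow N).measurable, ?_⟩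
  have h1 := hν.map_withDensity hN h.continuous h.nonneg (f := 1) fun _ => zero_le_one
  have h2 : ∀ x, ruelle N W (1 : Circle → ℝ) x = 1 := h.ruelle_one
  simpa [h2] using h1

theorem ergodic (h : IsAdmissibleWeight N W) (hN : 2 ≤ N) (hν : IsInvariantMeasure N W ν) :
    Ergodic (fun z : Circle => z ^ N) ν := by
  have hN0 : N ≠ 0 := by omega
  have := hν.1
  refine ⟨hν.measurePreserving h hN0, ⟨fun A hA hpre => ?_⟩⟩
  rcases eq_or_ne (ν A) 0 with h0 | h0
  · exact (eventuallyConst_set'.2 (Or.inl (ae_eq_empty.2 h0)))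
  · have hcond : IsInvariantMeasure N W (ProbabilityTheory.cond ν A) := by
      refine ⟨ProbabilityTheory.cond_isProbabilityMeasure h0, fun f => ?_⟩
      rw [ProbabilityTheory.cond, integral_smul_measure, integral_smul_measure,
        hν.setIntegral_ruelle h hN0 f hA, hpre]
    have heq := h.invariantMeasure_unique hN hcond hν
    refine eventuallyConst_set'.2 (Or.inr (ae_eq_univ.2 ?_))
    rw [← heq, ProbabilityTheory.cond_apply hA]
    simp

end IsInvariantMeasure

/-- Two distinct ergodic probability measures are mutually singular. -/
theorem Ergodic.mutuallySingular_of_ne {X : Type*} {m : MeasurableSpace X} {μ ν : Measure X}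
    {r : X → X} [IsProbabilityMeasure μ] [IsProbabilityMeasure ν] (hμ : Ergodic r μ)
    (hν : Ergodic r ν) (hne : μ ≠ ν) : μ ⟂ₘ ν := by
  -- The absolutely continuous part of `μ` is `r`-invariant, hence `c • ν` by ergodicity of `ν`. If
  -- `c = 0`, `μ` is purely singular; otherwise `ν ≪ μ`, and ergodicity of `μ` gives `ν = μ`.
  have hac := hμ.toMeasurePreserving.withDensity_rnDeriv hν.toMeasurePreserving
  obtain ⟨c, hc⟩ := hν.eq_smul_of_absolutelyContinuous hac (withDensity_absolutelyContinuous _ _)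
  rcases eq_or_ne c 0 with rfl | hc0
  · rw [zero_smul] at hc
    rw [Measure.haveLebesgueDecomposition_add μ ν, hc, add_zero]
    exact Measure.mutuallySingular_singularPart μ ν
  · exfalso
    have h1 : ν ≪ μ :=
      ((Measure.absolutelyContinuous_smul hc0).trans hc.symm.absolutelyContinuous).trans
        (Measure.absolutelyContinuous_of_le (Measure.withDensity_rnDeriv_le μ ν))
    exact hne (hμ.eq_of_absolutelyContinuous hν.toMeasurePreserving h1).symm

theorem IsAdmissibleWeight.mutuallySingular {N : ℕ} {W W' : Circle → ℝ} {ν ν' : Measure Circle}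
    (h : IsAdmissibleWeight N W) (h' : IsAdmissibleWeight N W') (hN : 2 ≤ N) (hne : W ≠ W')
    (hν : IsInvariantMeasure N W ν) (hν' : IsInvariantMeasure N W' ν') : ν ⟂ₘ ν' := by
  have := hν.1
  have := hν'.1
  refine Ergodic.mutuallySingular_of_ne (hν.ergodic h hN) (hν'.ergodic h' hN) ?_
  rintro rfl
  exact hne (h.eq_of_isInvariantMeasure h' hN hν hν')

/-! ### Haar measure and the constant weight -/

instance : IsProbabilityMeasure circleHaar := by
  refine ⟨?_⟩
  have := Measure.haarMeasure_self (K₀ := (⊤ : TopologicalSpace.PositiveCompacts Circle))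
  simpa [circleHaar] using this

instance : circleHaar.IsHaarMeasure := by
  unfold circleHaar
  infer_instance

theorem ruelle_pow_eq_sum {N : ℕ} (hN : N ≠ 0) (W f : Circle → ℝ) (z : Circle) :
    ruelle N W f (z ^ N) = ∑ w ∈ rootSet hN 1, W (w * z) * f (w * z) := by
  rw [ruelle_eq_sum hN]
  refine Finset.sum_bij' (fun y _ => y * z⁻¹) (fun w _ => w * z) ?_ ?_ ?_ ?_ ?_ <;>
    simp +contextual [mul_pow]

theorem card_rootSet {N : ℕ} (hN : N ≠ 0) : (rootSet hN 1).card = N := by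
  have h1 := ruelle_eq_sum hN (fun _ => 1) (fun _ => 1) 1
  have h2 := ruelle_exp hN (fun _ => 1) (fun _ => 1) 0
  rw [Circle.exp_zero] at h2
  rw [h1] at h2
  simpa using h2

theorem measurePreserving_circle_pow {N : ℕ} (hN : N ≠ 0) :
    MeasurePreserving (fun z : Circle => z ^ N) circleHaar circleHaar :=
  (powMonoidHom N : Circle →* Circle).measurePreserving (continuous_pow N) (fun x => by
    obtain ⟨t, rfl⟩ := Circle.exp_surjective x
    exact ⟨rootBranch N t 0, (pow_eq_exp_iff hN t _).2
      ⟨0, Finset.mem_range.2 (Nat.pos_of_ne_zero hN), rfl⟩⟩) rfl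

/-- Pulled back by `r`, which preserves Haar measure, `R_{1/N} f` is the average of `f` over
rotations by the `N`-th roots of unity. -/
theorem integral_ruelle_const_circleHaar {N : ℕ} (hN : N ≠ 0) (f : C(Circle, ℝ)) :
    ∫ x, ruelle N (fun _ => 1 / (N : ℝ)) f x ∂circleHaar = ∫ x, f x ∂circleHaar := by
  have hcont : Continuous (ruelle N (fun _ => 1 / (N : ℝ)) f) :=
    continuous_ruelle hN continuous_const f.continuous
  have hmp := measurePreserving_circle_pow hN
  have h1 : ∫ x, ruelle N (fun _ => 1 / (N : ℝ)) f x ∂circleHaar =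
      ∫ z, ruelle N (fun _ => 1 / (N : ℝ)) f (z ^ N) ∂circleHaar := by
    conv_lhs => rw [← hmp.map_eq]
    exact integral_map hmp.measurable.aemeasurable hcont.aestronglyMeasurable
  rw [h1]
  simp only [ruelle_pow_eq_sum hN]
  rw [integral_finsetSum]
  · simp only [integral_const_mul, integral_mul_left_eq_self (μ := circleHaar) (fun z => f z),
      Finset.sum_const, card_rootSet hN, nsmul_eq_mul]
    field_simp
  · intro w _
    exact ContinuousMap.integrable_circle ⟨fun z => 1 / (N : ℝ) * f (w * z), by fun_prop⟩ _

theorem isInvariantMeasure_circleHaar {N : ℕ} (hN : N ≠ 0) :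
    IsInvariantMeasure N (fun _ => 1 / (N : ℝ)) circleHaar :=
  ⟨inferInstance, integral_ruelle_const_circleHaar hN⟩

theorem isAdmissibleWeight_const {N : ℕ} (hN : 2 ≤ N) :
    IsAdmissibleWeight N fun _ => 1 / (N : ℝ) := by
  have hN0 : N ≠ 0 := by omega
  have hN' : (N : ℝ) ≠ 0 := Nat.cast_ne_zero.2 hN0
  refine ⟨fun _ => by positivity, ⟨0, LipschitzWith.const _⟩, fun x => ?_, fun x hx => ?_, ?_⟩
  · obtain ⟨t, rfl⟩ := Circle.exp_surjective x
    rw [ruelle_exp hN0]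
    simp [hN']
  · have h1 := hx.2 0
    rw [div_eq_one_iff_eq hN'] at h1
    have : N = 1 := by exact_mod_cast h1.symm
    omega
  · simp [hN0]

/-! ### The Riesz weight is admissible -/

theorem rieszWeight_eq (z : Circle) : rieszWeight z = (1 / 3) * (1 + ((z : ℂ) ^ 2).re) := by
  have h2 : ‖(Real.sqrt 2 : ℂ)‖ ^ 2 = 2 := by
    rw [Complex.norm_real, Real.norm_eq_abs, sq_abs, Real.sq_sqrt zero_le_two]
  have h1 : ‖(1 + (z : ℂ) ^ 2)‖ ^ 2 = 2 + 2 * ((z : ℂ) ^ 2).re := by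
    have h3 : Complex.normSq ((z : ℂ) ^ 2) = 1 := by simp
    rw [← Complex.normSq_eq_norm_sq, Complex.normSq_add, h3]
    simp only [map_one, one_mul, Complex.conj_re]
    ring
  rw [rieszWeight, norm_div, div_pow, h1, h2]
  ring

theorem Circle.norm_pow_coe (z : Circle) (n : ℕ) : ‖(z : ℂ) ^ n‖ = 1 := by
  simp [Circle.norm_coe]

theorem abs_re_pow_le_one (z : Circle) (n : ℕ) : |((z : ℂ) ^ n).re| ≤ 1 :=
  (Complex.abs_re_le_norm _).trans (Circle.norm_pow_coe z n).le

theorem ruelle_rieszWeight_one (x : Circle) : ruelle 3 rieszWeight (fun _ => 1) x = 1 := by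
  obtain ⟨t, rfl⟩ := Circle.exp_surjective x
  have hre : ∀ s : ℝ, ((Circle.exp s : ℂ) ^ 2).re = Real.cos (2 * s) := by
    intro s
    rw [Circle.coe_exp, ← Complex.exp_nat_mul, ← Complex.exp_ofReal_mul_I_re]
    congr 2
    push_cast
    ring
  rw [ruelle_exp three_ne_zero]
  simp only [rieszWeight_eq, rootBranch, hre, Finset.sum_range_succ, Finset.sum_range_zero]
  have hc : Real.cos (2 * ((t + 2 * Real.pi * (1 : ℕ)) / (3 : ℕ))) +
      Real.cos (2 * ((t + 2 * Real.pi * (2 : ℕ)) / (3 : ℕ))) =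
      - Real.cos (2 * ((t + 2 * Real.pi * (0 : ℕ)) / (3 : ℕ))) := by
    rw [Real.cos_add_cos]
    have e1 : (2 * ((t + 2 * Real.pi * (1 : ℕ)) / (3 : ℕ)) +
        2 * ((t + 2 * Real.pi * (2 : ℕ)) / (3 : ℕ))) / 2 =
        2 * ((t + 2 * Real.pi * (0 : ℕ)) / (3 : ℕ)) + 2 * Real.pi := by
      push_cast
      ring
    have e2 : (2 * ((t + 2 * Real.pi * (1 : ℕ)) / (3 : ℕ)) -
        2 * ((t + 2 * Real.pi * (2 : ℕ)) / (3 : ℕ))) / 2 = -(Real.pi - Real.pi / 3) := by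
      push_cast
      ring
    rw [e1, e2, Real.cos_add_two_pi, Real.cos_neg, Real.cos_pi_sub, Real.cos_pi_div_three]
    ring
  linarith

theorem isAdmissibleWeight_rieszWeight : IsAdmissibleWeight 3 rieszWeight where
  nonneg z := by unfold rieszWeight; positivity
  lipschitz := by
    refine ⟨1, LipschitzWith.of_dist_le_mul fun z w => ?_⟩
    have hd : dist z w = ‖(z : ℂ) - (w : ℂ)‖ := by rw [← Complex.dist_eq]; rfl
    have h1 : |((z : ℂ) ^ 2).re - ((w : ℂ) ^ 2).re| ≤ 2 * ‖(z : ℂ) - (w : ℂ)‖ := by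
      rw [← Complex.sub_re]
      refine (Complex.abs_re_le_norm _).trans ?_
      rw [sq_sub_sq, norm_mul]
      refine mul_le_mul_of_nonneg_right ?_ (norm_nonneg _)
      refine (norm_add_le _ _).trans ?_
      rw [Circle.norm_coe, Circle.norm_coe]
      norm_num
    rw [Real.dist_eq, hd, rieszWeight_eq, rieszWeight_eq]
    have e : 1 / 3 * (1 + ((z : ℂ) ^ 2).re) - 1 / 3 * (1 + ((w : ℂ) ^ 2).re) =
        1 / 3 * (((z : ℂ) ^ 2).re - ((w : ℂ) ^ 2).re) := by ring
    rw [e, abs_mul, abs_of_pos (by norm_num : (0 : ℝ) < 1 / 3), NNReal.coe_one]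
    have := norm_nonneg ((z : ℂ) - (w : ℂ))
    linarith
  ruelle_one := ruelle_rieszWeight_one
  -- The weight never exceeds `2/3`.
  no_cycle x hx := by
    have h1 := hx.2 0
    rw [Function.iterate_zero_apply, rieszWeight_eq] at h1
    have h2 := (abs_le.1 (abs_re_pow_le_one x 2)).2
    linarith
  finite_zeros := by
    refine (finite_roots two_ne_zero (-1)).subset fun z hz => ?_
    have hz' : rieszWeight z = 0 := hz
    have h2 : (Real.sqrt 2 : ℂ) ≠ 0 := by simp
    simp only [rieszWeight, mul_eq_zero, pow_eq_zero_iff two_ne_zero, norm_eq_zero, div_eq_zero_iff,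
      h2, or_false] at hz'
    have h3 : 1 + (z : ℂ) ^ 2 = 0 := by
      rcases hz' with h | h
      · norm_num at h
      · exact h
    change z ^ 2 = -1
    ext
    push_cast
    linear_combination h3

theorem rieszWeight_ne_const : rieszWeight ≠ fun _ => 1 / ((3 : ℕ) : ℝ) := by
  intro h
  have h1 := congrFun h 1
  rw [rieszWeight_eq] at h1
  norm_num at h1

/-! ### The Riesz product -/

theorem continuous_rieszPartial (n : ℕ) : Continuous (rieszPartial n) := by
  unfold rieszPartial
  fun_prop

theorem rieszPartial_nonneg (n : ℕ) (z : Circle) : 0 ≤ rieszPartial n z :=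
  Finset.prod_nonneg fun k _ => by
    have := (abs_le.1 (abs_re_pow_le_one z (2 * 3 ^ k))).1
    linarith

theorem rieszPartial_succ (n : ℕ) (z : Circle) :
    rieszPartial (n + 1) z = rieszPartial n z * (1 + ((z : ℂ) ^ (2 * 3 ^ n)).re) :=
  Finset.prod_range_succ _ _

/-- Splitting off the factor `k = 0`, rather than the last one, relates the density to `r` and `W`.
-/
theorem rieszPartial_succ' (n : ℕ) (z : Circle) :
    rieszPartial (n + 1) z = rieszPartial n (z ^ 3) * (3 * rieszWeight z) := by
  rw [rieszPartial, Finset.prod_range_succ', rieszWeight_eq, rieszPartial]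
  congr 1
  · refine Finset.prod_congr rfl fun k _ => ?_
    rw [Circle.coe_pow, ← pow_mul, show 3 * (2 * 3 ^ k) = 2 * 3 ^ (k + 1) by ring]
  · simp

theorem integral_zpow_circleHaar {m : ℤ} (hm : m ≠ 0) :
    ∫ z : Circle, (z : ℂ) ^ m ∂circleHaar = 0 := by
  have hm' : (m : ℝ) ≠ 0 := Int.cast_ne_zero.2 hm
  have hw : Circle.exp (Real.pi / m) ^ m = Circle.exp Real.pi := by
    rw [← Circle.exp_intCast_mul]
    congr 1
    field_simp
  have hw' : ((Circle.exp (Real.pi / m) : Circle) : ℂ) ^ m = -1 := by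
    rw [← Circle.coe_zpow, hw, Circle.coe_exp, Complex.exp_pi_mul_I]
  -- Rotation by `π / m` changes the sign of `z ^ m`.
  have h := integral_mul_left_eq_self (μ := circleHaar) (fun z : Circle => (z : ℂ) ^ m)
    (Circle.exp (Real.pi / m))
  simp only [Circle.coe_mul, mul_zpow, hw', integral_const_mul] at h
  linear_combination (-1 / 2 : ℂ) * h

/-- The integral of a complex continuous function against a partial Riesz product. -/
def rieszIntegral (n : ℕ) (F : Circle → ℂ) : ℂ :=
  ∫ z, F z * (rieszPartial n z : ℂ) ∂circleHaar

theorem integrable_mul_rieszPartial (n : ℕ) {F : Circle → ℂ} (hF : Continuous F) :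
    Integrable (fun z => F z * (rieszPartial n z : ℂ)) circleHaar := by
  have h := continuous_rieszPartial n
  exact Continuous.integrable_of_hasCompactSupport (by fun_prop)
    (HasCompactSupport.of_compactSpace _)

theorem Circle.continuous_coe_zpow (m : ℤ) : Continuous fun z : Circle => (z : ℂ) ^ m :=
  Continuous.zpow₀ (by fun_prop) m fun z => Or.inl z.coe_ne_zero

theorem rieszIntegral_succ_zpow (n : ℕ) (m : ℤ) :
    rieszIntegral (n + 1) (fun z => (z : ℂ) ^ m) =
      rieszIntegral n (fun z => (z : ℂ) ^ m) +
        (1 / 2 * rieszIntegral n (fun z => (z : ℂ) ^ (m + 2 * 3 ^ n)) +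
          1 / 2 * rieszIntegral n (fun z => (z : ℂ) ^ (m - 2 * 3 ^ n))) := by
  have hi := fun m : ℤ => integrable_mul_rieszPartial n (Circle.continuous_coe_zpow m)
  have hsum : Integrable (fun z : Circle =>
      1 / 2 * ((z : ℂ) ^ (m + 2 * 3 ^ n) * (rieszPartial n z : ℂ)) +
        1 / 2 * ((z : ℂ) ^ (m - 2 * 3 ^ n) * (rieszPartial n z : ℂ))) circleHaar :=
    ((hi _).const_mul _).add ((hi _).const_mul _)
  simp only [rieszIntegral]
  rw [← integral_const_mul, ← integral_const_mul,
    ← integral_add ((hi _).const_mul _) ((hi _).const_mul _),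
    ← integral_add (hi _) hsum]
  refine integral_congr_ae (ae_of_all _ fun z => ?_)
  have hre : ((((z : ℂ) ^ (2 * 3 ^ n)).re : ℝ) : ℂ) =
      1 / 2 * (z : ℂ) ^ (2 * 3 ^ n : ℤ) + 1 / 2 * ((z : ℂ) ^ (2 * 3 ^ n : ℤ))⁻¹ := by
    rw [Complex.re_eq_add_conj, ← Circle.coe_pow, ← Circle.coe_inv_eq_conj]
    have e : (z : ℂ) ^ (2 * 3 ^ n : ℤ) = ((z ^ (2 * 3 ^ n) : Circle) : ℂ) := by
      rw [Circle.coe_pow, ← zpow_natCast]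
      push_cast
      rfl
    rw [e, Circle.coe_inv]
    ring
  simp only [rieszPartial_succ]
  push_cast
  rw [hre, zpow_add₀ z.coe_ne_zero, zpow_sub₀ z.coe_ne_zero]
  ring

/-- The frequencies of the partial product are smaller than `3 ^ n`: a new factor shifts by `±
2·3^n`, and `3^(n+1) - 2·3^n = 3^n`. -/
theorem rieszIntegral_zpow_eq_zero (n : ℕ) (m : ℤ) (hm : 3 ^ n ≤ |m|) :
    rieszIntegral n (fun z => (z : ℂ) ^ m) = 0 := by
  induction n generalizing m with
  | zero =>
    have h0 : m ≠ 0 := by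
      rintro rfl
      simp at hm
    simpa [rieszIntegral, rieszPartial] using integral_zpow_circleHaar h0
  | succ n ih =>
    have h3 : (0 : ℤ) < 3 ^ n := by positivity
    rw [pow_succ] at hm
    rw [rieszIntegral_succ_zpow, ih m (by linarith), ih (m + 2 * 3 ^ n), ih (m - 2 * 3 ^ n)]
    · simp
    all_goals
      rw [le_abs] at hm ⊢
      rcases hm with hm | hm
      · left; linarith
      · right; linarith

/-- Both shifted frequencies `m ± 2·3^n` have modulus at least `3^n`, so low coefficients no longer
change. -/
theorem rieszIntegral_succ_zpow_eq {n : ℕ} {m : ℤ} (hm : |m| ≤ 3 ^ n) :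
    rieszIntegral (n + 1) (fun z => (z : ℂ) ^ m) = rieszIntegral n (fun z => (z : ℂ) ^ m) := by
  have h3 : (0 : ℤ) < 3 ^ n := by positivity
  rw [abs_le] at hm
  rw [rieszIntegral_succ_zpow, rieszIntegral_zpow_eq_zero n (m + 2 * 3 ^ n),
    rieszIntegral_zpow_eq_zero n (m - 2 * 3 ^ n)]
  · simp
  · rw [le_abs]; right; linarith
  · rw [le_abs]; left; linarith

theorem integral_rieszPartial (n : ℕ) : ∫ z, rieszPartial n z ∂circleHaar = 1 := by
  have h : rieszIntegral n (fun z => (z : ℂ) ^ (0 : ℤ)) = 1 := by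
    induction n with
    | zero => simp [rieszIntegral, rieszPartial]
    | succ n ih => rw [rieszIntegral_succ_zpow_eq (by simp), ih]
  simp only [rieszIntegral, zpow_zero, one_mul, integral_complex_ofReal] at h
  exact_mod_cast h

theorem cauchySeq_rieszIntegral_zpow (m : ℤ) :
    CauchySeq fun n => rieszIntegral n (fun z => (z : ℂ) ^ m) := by
  refine Tendsto.cauchySeq (x := rieszIntegral m.natAbs fun z => (z : ℂ) ^ m)
    (tendsto_atTop_of_eventually_const (i₀ := m.natAbs) fun n hn => ?_)
  induction n, hn using Nat.le_induction with
  | base => rfl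
  | succ n hn ih =>
    rw [rieszIntegral_succ_zpow_eq, ih]
    have h1 : m.natAbs ≤ 3 ^ n := hn.trans (Nat.lt_pow_self (by norm_num)).le
    rw [Int.abs_eq_natAbs]
    exact_mod_cast h1

theorem norm_rieszIntegral_le (n : ℕ) {F : Circle → ℂ} {C : ℝ} (hF : ∀ z, ‖F z‖ ≤ C) :
    ‖rieszIntegral n F‖ ≤ C := by
  have h : ∫ z, C * rieszPartial n z ∂circleHaar = C := by
    rw [integral_const_mul, integral_rieszPartial, mul_one]
  have hc := continuous_rieszPartial n
  rw [← h]
  refine norm_integral_le_of_norm_le (Continuous.integrable_of_hasCompactSupport (by fun_prop)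
    (HasCompactSupport.of_compactSpace _)) (ae_of_all _ fun z => ?_)
  rw [norm_mul, Complex.norm_real, Real.norm_of_nonneg (rieszPartial_nonneg n z)]
  exact mul_le_mul_of_nonneg_right (hF z) (rieszPartial_nonneg n z)

theorem rieszIntegral_add (n : ℕ) {F G : Circle → ℂ} (hF : Continuous F) (hG : Continuous G) :
    rieszIntegral n (fun z => F z + G z) = rieszIntegral n F + rieszIntegral n G := by
  simp only [rieszIntegral, add_mul]
  exact integral_add (integrable_mul_rieszPartial n hF) (integrable_mul_rieszPartial n hG)

theorem rieszIntegral_const_mul (n : ℕ) (c : ℂ) (F : Circle → ℂ) :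
    rieszIntegral n (fun z => c * F z) = c * rieszIntegral n F := by
  simp only [rieszIntegral, mul_assoc]
  exact integral_const_mul _ _

/-- The functionals have norm at most `1`, so convergence passes from trigonometric polynomials to
their uniform closure. The detour through `AddCircle` gives access to the density of Fourier
monomials. -/
theorem cauchySeq_rieszIntegral {F : Circle → ℂ} (hF : Continuous F) :
    CauchySeq fun n => rieszIntegral n F := by
  let e : AddCircle (1 : ℝ) ≃ₜ Circle := AddCircle.homeomorphCircle one_ne_zero
  have hcomp : ∀ G : C(AddCircle (1 : ℝ), ℂ), Continuous fun z => G (e.symm z) := fun G =>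
    G.continuous.comp e.symm.continuous
  let S : Submodule ℂ C(AddCircle (1 : ℝ), ℂ) :=
    { carrier := {G | CauchySeq fun n => rieszIntegral n fun z => G (e.symm z)}
      add_mem' := fun {G H} hG hH => by
        change CauchySeq fun n => rieszIntegral n fun z => G (e.symm z) + H (e.symm z)
        simp only [rieszIntegral_add _ (hcomp G) (hcomp H)]
        exact CauchySeq.add hG hH
      zero_mem' := by
        change CauchySeq fun n => rieszIntegral n fun z => 0
        simp only [rieszIntegral, zero_mul, integral_zero]
        exact tendsto_const_nhds.cauchySeq
      smul_mem' := fun c G hG => by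
        change CauchySeq fun n => rieszIntegral n fun z => c * G (e.symm z)
        simp only [rieszIntegral_const_mul]
        obtain ⟨a, ha⟩ := cauchySeq_tendsto_of_complete hG
        exact (ha.const_mul c).cauchySeq }
  have hclosed : IsClosed (S : Set C(AddCircle (1 : ℝ), ℂ)) := by
    refine isClosed_of_closure_subset fun G hG => ?_
    refine Metric.cauchySeq_iff'.2 fun ε hε => ?_
    obtain ⟨H, hH, hGH⟩ := Metric.mem_closure_iff.1 hG (ε / 3) (by positivity)
    obtain ⟨n₀, hn₀⟩ := Metric.cauchySeq_iff'.1 hH (ε / 3) (by positivity)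
    refine ⟨n₀, fun n hn => ?_⟩
    have hbound : ∀ k, dist (rieszIntegral k fun z => G (e.symm z))
        (rieszIntegral k fun z => H (e.symm z)) ≤ dist G H := by
      intro k
      have h1 := rieszIntegral_add k (hcomp (G - H)) (hcomp H)
      have h2 : (fun z => (G - H) (e.symm z) + H (e.symm z)) = fun z => G (e.symm z) := by
        ext z; simp
      rw [h2] at h1
      rw [h1, dist_eq_norm, add_sub_cancel_right, dist_eq_norm]
      exact norm_rieszIntegral_le k fun z => (G - H).norm_coe_le_norm _
    have h1 := hbound n
    have h2 := hbound n₀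
    have h3 := hn₀ n hn
    rw [dist_comm] at h2
    calc _ ≤ _ := dist_triangle4 _ (rieszIntegral n fun z => H (e.symm z))
            (rieszIntegral n₀ fun z => H (e.symm z)) _
      _ < ε := by linarith
  have hS : S = ⊤ := by
    rw [← top_le_iff, ← span_fourier_closure_eq_top]
    refine Submodule.topologicalClosure_minimal _ (Submodule.span_le.2 ?_) hclosed
    rintro _ ⟨m, rfl⟩
    have hm : ∀ z : Circle, fourier m (e.symm z) = (z : ℂ) ^ m := by
      intro z
      rw [fourier_apply, AddCircle.toCircle_zsmul, Circle.coe_zpow]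
      congr 2
      exact (AddCircle.homeomorphCircle_apply one_ne_zero _).symm.trans (e.apply_symm_apply z)
    change CauchySeq fun n => rieszIntegral n fun z => fourier m (e.symm z)
    simp only [hm]
    exact cauchySeq_rieszIntegral_zpow m
  have hmem : (⟨fun x => F (e x), hF.comp e.continuous⟩ : C(AddCircle (1 : ℝ), ℂ)) ∈ S :=
    hS ▸ Submodule.mem_top
  have : CauchySeq fun n => rieszIntegral n fun z => F (e (e.symm z)) := hmem
  simpa using this

theorem exists_isRieszProduct : ∃ ν : Measure Circle, IsRieszProduct ν := by
  have hint : ∀ (n : ℕ) (f : C(Circle, ℝ)),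
      Integrable (fun z => f z * rieszPartial n z) circleHaar := fun n f =>
    ContinuousMap.integrable_circle ⟨_, f.continuous.mul (continuous_rieszPartial n)⟩ _
  let T : ℕ → C(Circle, ℝ) →ₗ[ℝ] ℝ := fun n =>
    { toFun := fun f => ∫ z, f z * rieszPartial n z ∂circleHaar
      map_add' := fun f g => by
        simp only [ContinuousMap.add_apply, add_mul]
        exact integral_add (hint n f) (hint n g)
      map_smul' := fun c f => by
        simp only [ContinuousMap.smul_apply, smul_eq_mul, mul_assoc, RingHom.id_apply]
        exact integral_const_mul _ _ }
  refine exists_probabilityMeasure_of_tendsto (l := atTop) T (fun n f hf => ?_) (fun n => ?_)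
    fun f => ?_
  · exact integral_nonneg fun z => mul_nonneg (hf z) (rieszPartial_nonneg n z)
  · simpa [T] using integral_rieszPartial n
  · obtain ⟨a, ha⟩ := cauchySeq_tendsto_of_complete (cauchySeq_rieszIntegral
      (F := fun z => ((f z : ℝ) : ℂ)) (by fun_prop))
    refine ⟨a.re, ((Complex.continuous_re.tendsto a).comp ha).congr fun n => ?_⟩
    have h1 : rieszIntegral n (fun z => ((f z : ℝ) : ℂ)) = ((T n f : ℝ) : ℂ) := by
      change _ = ((∫ z, f z * rieszPartial n z ∂circleHaar : ℝ) : ℂ)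
      rw [← integral_complex_ofReal]
      simp only [rieszIntegral, Complex.ofReal_mul]
    rw [Function.comp_apply, h1, Complex.ofReal_re]

/-- With `P_n` the partial product, `P_{n+1} = (P_n ∘ r) · 3W` gives `R_{1/3}(f P_{n+1}) = P_n · R_W
f`. Integrating against Haar measure and letting `n → ∞` gives invariance. -/
theorem IsRieszProduct.isInvariantMeasure {ν : Measure Circle} (hν : IsRieszProduct ν) :
    IsInvariantMeasure 3 rieszWeight ν := by
  have hW := isAdmissibleWeight_rieszWeight.continuous
  refine ⟨hν.1, fun f => ?_⟩
  let Rf : C(Circle, ℝ) := ⟨_, continuous_ruelle three_ne_zero hW f.continuous⟩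
  refine tendsto_nhds_unique (hν.2 Rf) (((hν.2 f).comp (tendsto_add_atTop_nat 1)).congr fun n => ?_)
  have h1 := integral_ruelle_const_circleHaar three_ne_zero
    ⟨_, f.continuous.mul (continuous_rieszPartial (n + 1))⟩
  refine h1.symm.trans (integral_congr_ae (ae_of_all _ fun x => ?_))
  change ruelle 3 _ (fun z => f z * rieszPartial (n + 1) z) x =
    ruelle 3 rieszWeight f x * rieszPartial n x
  rw [mul_comm, ← ruelle_comp_pow_mul three_ne_zero, ruelle_eq_sum three_ne_zero,
    ruelle_eq_sum three_ne_zero]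
  refine Finset.sum_congr rfl fun y _ => ?_
  rw [rieszPartial_succ']
  push_cast
  ring

end

theorem corollary5p15 :
    (∀ N : ℕ, 2 ≤ N →
      (∀ W : Circle → ℝ, IsAdmissibleWeight N W →
        ∃! ν : Measure Circle, IsInvariantMeasure N W ν) ∧
      (∀ W W' : Circle → ℝ, IsAdmissibleWeight N W → IsAdmissibleWeight N W' → W ≠ W' →
        ∀ ν ν' : Measure Circle, IsInvariantMeasure N W ν → IsInvariantMeasure N W' ν' →
          ν ⟂ₘ ν') ∧
      (∀ W : Circle → ℝ, IsAdmissibleWeight N W → W ≠ (fun _ => 1 / (N : ℝ)) →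
        ∀ ν : Measure Circle, IsInvariantMeasure N W ν → ν ⟂ₘ circleHaar)) ∧
    (∃ ν : Measure Circle, IsRieszProduct ν ∧ IsInvariantMeasure 3 rieszWeight ν ∧
      ν ⟂ₘ circleHaar) := by
  have hHaar : ∀ N : ℕ, 2 ≤ N → ∀ W : Circle → ℝ, IsAdmissibleWeight N W →
      W ≠ (fun _ => 1 / (N : ℝ)) → ∀ ν : Measure Circle, IsInvariantMeasure N W ν →
      ν ⟂ₘ circleHaar := fun N hN W h hne ν hν =>
    h.mutuallySingular (isAdmissibleWeight_const hN) hN hne hν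
      (isInvariantMeasure_circleHaar (by omega))
  refine ⟨fun N hN => ⟨fun W h => ?_, fun W W' h h' hne ν ν' hν hν' => ?_, hHaar N hN⟩, ?_⟩
  · obtain ⟨ν, hν⟩ := h.exists_invariantMeasure hN
    exact ⟨ν, hν, fun μ hμ => h.invariantMeasure_unique hN hμ hν⟩
  · exact h.mutuallySingular h' hN hne hν hν'
  · obtain ⟨ν, hν⟩ := exists_isRieszProduct
    exact ⟨ν, hν, hν.isInvariantMeasure, hHaar 3 (by norm_num) _ isAdmissibleWeight_rieszWeight
      rieszWeight_ne_const ν hν.isInvariantMeasure⟩
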